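/- Let $m\ge 1$, let $A$ be a symmetric, irreducible $m\times m$ matrix with non-negative entries, and let $p_1,\dots,p_m\ge 0$ with $\sum_i p_i=1$ and $p_iA_{ij}p_j>0$ for at least one pair $i,j$ (this is automatic if all $p_i>0$). Put $P=\mathrm{diag}(p_1,\dots,p_m)$ and $K(\mathbf k,\mathbf l)=\mathbf k^TA\mathbf l$. For a square matrix $M$ with non-negative entries write $\|M\|_2$ for its spectral radius (Perron--Frobenius eigenvalue). Consider the reduced multicomponent Smoluchowski equation $$\frac{\mathrm d w_{\mathbf n}}{\mathrm dt}=\frac12\sum_{\mathbf k+\mathbf l=\mathbf n}K(\mathbf k,\mathbf l)\,w_{\mathbf k}w_{\mathbf l}-\mathbf n^TA\,\mathbf m(0)\,w_{\mathbf n},\qquad \mathbf n\in\mathbb N_0^m,\ t\ge 0,$$ with monodisperse initial condition $w_{\mathbf e_i}(0)=p_i$ for $i=1,\dots,m$ and $w_{\mathbf n}(0)=0$ for all other $\mathbf n$, where $\mathbf m(t)=\sum_{\mathbf n}\mathbf n\,w_{\mathbf n}(t)$ is the total mass vector. Its gelation time is the number $T\in(0,\infty)$ such that $\mathbf m(t)=\mathbf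 m(0)$ for all $t\in[0,T)$ and, for every $t>T$, $\mathbf m_i(t)<\mathbf m_i(0)$ for some $i$ (all the series $\mathbf m_i(t)$, $t\ge0$, being convergent). For $t\ge0$ consider also the multi-type branching process with types $1,\dots,m$ whose root has type $k$ with probability $p_k$ and in which the offspring vector $\mathbf X_k$ of an individual of type $k$ has probability generating function $\prod_{l=1}^m\exp(tA_{kl}p_l(s_l-1))$; it is called critical if its matrix of expected offspring numbers $M_{ij}=\mathbb E[X_{i,j}]$ satisfies $\|M\|_2=1$. Then: (1) there is exactly one time $T_c\ge 0$ at which the branching process is critical, namely $T_c=1/\|AP\|_2\in(0,\infty)$; (2) the reduced equation has a solution on $[0,\infty)$, and every solution has a gelation time, which equals the critical time $T_c$. -/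

import Mathlib

open MeasureTheory ProbabilityTheory

noncomputable section

namespace MultiCoag

/-! ### The reduced multicomponent Smoluchowski equation -/

/-- The coagulation kernel `K(k, l) = kᵀ A l` for `k, l ∈ ℕ₀^m`. -/
def kernel {m : ℕ} (A : Matrix (Fin m) (Fin m) ℝ) (k l : Fin m → ℕ) : ℝ :=
  (fun i => (k i : ℝ)) ⬝ᵥ A.mulVec (fun j => (l j : ℝ))

/-- The total mass vector `𝐦_i = ∑_n n_i v_n` of a size distribution `v`. -/
def totalMass {m : ℕ} (v : (Fin m → ℕ) → ℝ) (i : Fin m) : ℝ :=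
  ∑' n : Fin m → ℕ, (n i : ℝ) * v n

/-- The monodisperse size distribution: mass `p i` at the unit vector `e_i`, zero elsewhere. -/
def monodisperse {m : ℕ} (p : Fin m → ℝ) (n : Fin m → ℕ) : ℝ :=
  ∑ i, if n = Pi.single i 1 then p i else 0

/-- The right-hand side of the reduced equation at `n`, with initial mass vector `m₀` and current
size distribution `v`: `1/2 ∑_{k + l = n} K(k, l) v_k v_l - (nᵀ A m₀) v_n`. -/
def reducedRhs {m : ℕ} (A : Matrix (Fin m) (Fin m) ℝ) (m₀ : Fin m → ℝ)
    (v : (Fin m → ℕ) → ℝ) (n : Fin m → ℕ) : ℝ :=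
  1 / 2 * (∑ kl ∈ Finset.Iic n ×ˢ Finset.Iic n with kl.1 + kl.2 = n,
      kernel A kl.1 kl.2 * v kl.1 * v kl.2)
    - ((fun i => (n i : ℝ)) ⬝ᵥ A.mulVec m₀) * v n

/-- `w` solves the reduced multicomponent Smoluchowski equation on `[0, ∞)` with monodisperse
initial condition `p` (one-sided derivative at `t = 0`). -/
structure IsReducedSolution {m : ℕ} (A : Matrix (Fin m) (Fin m) ℝ) (p : Fin m → ℝ)
    (w : ℝ → (Fin m → ℕ) → ℝ) : Prop where
  initial : w 0 = monodisperse p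
  ode : ∀ t : ℝ, 0 ≤ t → ∀ n : Fin m → ℕ,
    HasDerivWithinAt (fun s => w s n) (reducedRhs A (totalMass (w 0)) (w t) n) (Set.Ici 0) t

/-- `T ∈ (0, ∞)` is the gelation time of the evolution `w`: the total mass vector (a convergent
series at all times) is conserved on `[0, T)`, and at every later time `t > T` some component of
it is strictly below its initial value. -/
structure IsGelationTime {m : ℕ} (w : ℝ → (Fin m → ℕ) → ℝ) (T : ℝ) : Prop where
  pos : 0 < T
  summable : ∀ t : ℝ, 0 ≤ t → ∀ i, Summable (fun n : Fin m → ℕ => (n i : ℝ) * w t n)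
  conserved : ∀ t : ℝ, 0 ≤ t → t < T → totalMass (w t) = totalMass (w 0)
  loss : ∀ t : ℝ, T < t → ∃ i, totalMass (w t) i < totalMass (w 0) i

/-! ### The multi-type branching process -/

/-- The spectral radius of a real square matrix: the largest modulus of a complex eigenvalue. -/
def specRadius {m : ℕ} (M : Matrix (Fin m) (Fin m) ℝ) : ℝ :=
  (spectralRadius ℂ (M.map (algebraMap ℝ ℂ))).toReal

/-- A multi-type branching process with types `Fin m`, given by the law of its root type and by
the law of the offspring vector `X_k` of an individual of type `k`, for each `k`. -/
structure BranchingProcess (m : ℕ) where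
  root : Fin m → ℝ
  offspring : Fin m → Measure (Fin m → ℕ)
  root_nonneg : ∀ k, 0 ≤ root k
  root_sum : ∑ k, root k = 1
  isProbability : ∀ k, IsProbabilityMeasure (offspring k)

/-- The matrix of expected offspring numbers, `M_{ij} = 𝔼[X_{i,j}]`. -/
def BranchingProcess.meanMatrix {m : ℕ} (B : BranchingProcess m) : Matrix (Fin m) (Fin m) ℝ :=
  fun i j => ∫ x, (x j : ℝ) ∂(B.offspring i)

/-- The branching process is critical: its mean matrix has spectral radius `1`. -/
def BranchingProcess.IsCritical {m : ℕ} (B : BranchingProcess m) : Prop :=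
  specRadius B.meanMatrix = 1

/-- The branching process at time `t ≥ 0` associated with the kernel matrix `A` and the initial
distribution `p`: the root has type `k` with probability `p k`, and an individual of type `k` has
independent `Poisson(t A_{kl} p_l)` numbers of children of the types `l`. -/
def assocProcess {m : ℕ} (A : Matrix (Fin m) (Fin m) ℝ) (p : Fin m → ℝ) (hp : ∀ i, 0 ≤ p i)
    (hp1 : ∑ i, p i = 1) (t : ℝ) : BranchingProcess m where
  root := p
  offspring k := Measure.pi fun l => poissonMeasure (t * A k l * p l).toNNReal
  root_nonneg := hp
  root_sum := hp1
  isProbability _ := inferInstance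

/-- The probability generating function of the offspring vector `X_k` is
`∏_l exp (t A_{kl} p_l (s_l - 1))`. -/
theorem assocProcess_pgf {m : ℕ} (A : Matrix (Fin m) (Fin m) ℝ) (hA : ∀ i j, 0 ≤ A i j)
    (p : Fin m → ℝ) (hp : ∀ i, 0 ≤ p i) (hp1 : ∑ i, p i = 1) (t : ℝ) (ht : 0 ≤ t) (k : Fin m)
    (s : Fin m → ℝ) :
    ∫ x, ∏ l, s l ^ x l ∂((assocProcess A p hp hp1 t).offspring k)
      = ∏ l, Real.exp (t * A k l * p l * (s l - 1)) := by
  have key : ∀ (r : NNReal) (a : ℝ),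
      ∫ n, a ^ n ∂(poissonMeasure r) = Real.exp (r * (a - 1)) := by
    intro r a
    rw [integral_poissonMeasure]
    have h := (NormedSpace.expSeries_div_hasSum_exp ((r : ℝ) * a)).mul_left (Real.exp (-r))
    rw [← Real.exp_eq_exp_ℝ, ← Real.exp_add] at h
    rw [show (r : ℝ) * (a - 1) = -r + r * a by ring, ← h.tsum_eq]
    refine tsum_congr fun n => ?_
    simp only [smul_eq_mul, mul_pow]
    ring
  change ∫ x, ∏ l, s l ^ x l ∂(Measure.pi _) = _
  rw [integral_fintype_prod_eq_prod (fun l (n : ℕ) => s l ^ n)]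
  refine Finset.prod_congr rfl fun l _ => ?_
  rw [key, Real.coe_toNNReal _ (mul_nonneg (mul_nonneg ht (hA k l)) (hp l))]

end MultiCoag

end

/-! The equation is triangular in $|n|=\sum_i n_i$, since its gain term couples only strictly
smaller clusters (`IsReducedSolution.eq_of_nonneg`). Its solution is therefore unique, and has the
form $w_n(t)=c_n t^{|n|-1}e^{-t\,n^TAp}$ with $2(|n|-1)c_n=\sum_{k+l=n}K(k,l)c_kc_l$. Everything
then depends on whether $g_i(1)=p_i$, where $g_i(s)=\sum_n n_iw_n(t)s^{|n|}$.

The link with branching is the total-progeny equation $g_i=s\,p_i\exp(-t(A(p-g))_i)$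
(`massSeries_eq`). It does not follow termwise from the recursion for $c$, which only gives a
quasilinear equation for $y_i=\theta_iC$, with $C=\sum_n c_nz^n$. A formal power series argument
turns that into $Ey_i=y_i+y_i(AEy)_i$, where $E=\sum_k\theta_k$ (`euler_theta_eq`). Along the ray
$z_i\propto s$ this says that $(g_i/s)e^{-t(Ag)_i}$ is constant. Convergence up to $s=1$ comes from
the bound $g_i\le p_i$, proved first for truncated sums (`sum_degree_le`).

Put $d=p-g$ and let $\rho$ be the spectral radius of $AP$. At $s=1$ the equation gives $d\le tPAd$;
if $t\rho<1$, iteration forces $d=0$. If $t\rho>1$ and $d(1)=0$, then near $s=1$ the equation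
linearises to $PtAd\le(1+\varepsilon)d$. Pairing with a nonnegative $u$ satisfying $APu\ge\rho u$
contradicts $1+\varepsilon<t\rho$. The mean matrix is $tAP$, so $1/\rho$ is also the critical time.
-/

namespace MultiCoag

/-! ### Formal power series: from the coagulation recursion to the rooted-tree recursion -/

section Formal

variable {σ : Type*}

/-- The derivation `z_j ∂/∂z_j` of the ring of formal power series. -/
noncomputable def theta (j : σ) : Derivation ℝ (MvPowerSeries σ ℝ) (MvPowerSeries σ ℝ) :=
  Derivation.mk'
    { toFun := fun f n => (n j : ℝ) * MvPowerSeries.coeff n f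
      map_add' := fun f g => by
        ext n
        change (n j : ℝ) * MvPowerSeries.coeff n (f + g) =
          (n j : ℝ) * MvPowerSeries.coeff n f + (n j : ℝ) * MvPowerSeries.coeff n g
        rw [map_add, mul_add]
      map_smul' := fun r f => by
        ext n
        change (n j : ℝ) * MvPowerSeries.coeff n (r • f) =
          r * ((n j : ℝ) * MvPowerSeries.coeff n f)
        rw [MvPowerSeries.coeff_smul]
        ring }
    (fun f g => by
      classical
      ext n
      change (n j : ℝ) * MvPowerSeries.coeff n (f * g) = MvPowerSeries.coeff n (f * _ + g * _)
      rw [mul_comm g, map_add, MvPowerSeries.coeff_mul, MvPowerSeries.coeff_mul,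
        MvPowerSeries.coeff_mul, Finset.mul_sum, ← Finset.sum_add_distrib]
      refine Finset.sum_congr rfl fun kl hkl => ?_
      rw [Finset.HasAntidiagonal.mem_antidiagonal] at hkl
      change _ = _ * ((kl.2 j : ℝ) * MvPowerSeries.coeff kl.2 g)
        + ((kl.1 j : ℝ) * MvPowerSeries.coeff kl.1 f) * _
      rw [← hkl, Finsupp.add_apply]
      push_cast
      ring)

theorem coeff_theta (j : σ) (f : MvPowerSeries σ ℝ) (n : σ →₀ ℕ) :
    MvPowerSeries.coeff n (theta j f) = (n j : ℝ) * MvPowerSeries.coeff n f := rfl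

theorem theta_comm (i j : σ) (f : MvPowerSeries σ ℝ) :
    theta i (theta j f) = theta j (theta i f) := by
  ext n
  simp only [coeff_theta]
  ring

variable [Fintype σ]

theorem cast_degree (n : σ →₀ ℕ) : ((n.degree : ℕ) : ℝ) = ∑ j, (n j : ℝ) := by
  rw [Finsupp.degree_eq_sum]
  push_cast
  rfl

theorem coeff_sum_theta (f : MvPowerSeries σ ℝ) (n : σ →₀ ℕ) :
    MvPowerSeries.coeff n (∑ j, theta j f) = (n.degree : ℝ) * MvPowerSeries.coeff n f := by
  rw [map_sum, cast_degree, Finset.sum_mul]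
  rfl

/-- A derivation applied entrywise to a product of matrices. -/
theorem map_derivation_mul {R : Type*} [CommRing R] [Algebra ℝ R] (D : Derivation ℝ R R)
    (M N : Matrix σ σ R) : (M * N).map D = M.map D * N + M * N.map D := by
  ext i j
  simp only [Matrix.map_apply, Matrix.mul_apply, Matrix.add_apply, map_sum, Derivation.leibniz,
    smul_eq_mul, ← Finset.sum_add_distrib]
  refine Finset.sum_congr rfl fun k _ => ?_
  ring

/-- Uniqueness for the linear first-order equation `(E - 1) U = ∑_j f_j θ_j U + U B`, whose
coefficients `f`, `B` have no constant term. -/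
theorem eq_zero_of_euler_eq (f : σ → MvPowerSeries σ ℝ) (B U : Matrix σ σ (MvPowerSeries σ ℝ))
    (hf : ∀ j, MvPowerSeries.coeff 0 (f j) = 0) (hB : ∀ i j, MvPowerSeries.coeff 0 (B i j) = 0)
    (hU : ∀ i j, ∀ n : σ →₀ ℕ, n.degree = 1 → MvPowerSeries.coeff n (U i j) = 0)
    (h : ∀ i j, ∑ k, theta k (U i j) - U i j = ∑ k, f k * theta k (U i j) + (U * B) i j) :
    U = 0 := by
  classical
  have key : ∀ N : ℕ, ∀ n : σ →₀ ℕ, n.degree = N → ∀ i j,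
      MvPowerSeries.coeff n (U i j) = 0 := by
    intro N
    induction N using Nat.strong_induction_on with
    | _ N ih =>
      intro n hn i j
      rcases eq_or_ne N 1 with rfl | hN
      · exact hU i j n hn
      -- The coefficients `f`, `B` have no constant term, so each surviving product on the right
      -- involves `U` in strictly lower degree. The factor $N-1$ on the left degenerates only at
      -- $N=1$, which is why degree one is a separate hypothesis.
      have lower : ∀ kl ∈ Finset.HasAntidiagonal.antidiagonal n, kl.1 ≠ 0 → kl.2.degree < N := by
        intro kl hkl h0
        rw [Finset.HasAntidiagonal.mem_antidiagonal] at hkl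
        rw [← hn, ← hkl, map_add]
        have := mt (Finsupp.degree_eq_zero_iff kl.1).1 h0
        omega
      have h1 := congrArg (MvPowerSeries.coeff n) (h i j)
      rw [map_sub, coeff_sum_theta, map_add, map_sum, Matrix.mul_apply, map_sum] at h1
      have e1 : ∀ k, MvPowerSeries.coeff n (f k * theta k (U i j)) = 0 := by
        intro k
        rw [MvPowerSeries.coeff_mul]
        refine Finset.sum_eq_zero fun kl hkl => ?_
        by_cases h0 : kl.1 = 0
        · rw [h0, hf, zero_mul]
        · rw [coeff_theta, ih _ (lower kl hkl h0) kl.2 rfl, mul_zero, mul_zero]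
      have e2 : ∀ k, MvPowerSeries.coeff n (U i k * B k j) = 0 := by
        intro k
        rw [mul_comm, MvPowerSeries.coeff_mul]
        refine Finset.sum_eq_zero fun kl hkl => ?_
        by_cases h0 : kl.1 = 0
        · rw [h0, hB, zero_mul]
        · rw [ih _ (lower kl hkl h0) kl.2 rfl, mul_zero]
      rw [Finset.sum_eq_zero fun k _ => e1 k, Finset.sum_eq_zero fun k _ => e2 k, hn] at h1
      have h2 : ((N : ℝ) - 1) * MvPowerSeries.coeff n (U i j) = 0 := by linarith
      refine (mul_eq_zero.1 h2).resolve_left fun h3 => hN ?_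
      exact_mod_cast sub_eq_zero.1 h3
  ext i j n
  exact key _ n rfl i j

variable [DecidableEq σ] (A : Matrix σ σ ℝ) (C : MvPowerSeries σ ℝ)

/-- If `(E - 1) C = ½ ∑ A_ij θ_i C θ_j C` with `A` symmetric, then `y_i = θ_i C` satisfies
`E y_i = y_i + y_i (A E y)_i`. -/
theorem euler_theta_eq (hA : A.IsSymm)
    (hC : (2 : ℝ) • (∑ k, theta k C - C) = ∑ i, ∑ j, A i j • (theta i C * theta j C)) (i : σ) :
    ∑ k, theta k (theta i C) - theta i C
      = theta i C * ∑ j, A i j • ∑ k, theta k (theta j C) := by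
  set y : σ → MvPowerSeries σ ℝ := fun i => theta i C with hy
  set S : Matrix σ σ (MvPowerSeries σ ℝ) := fun i j => theta j (y i) with hS
  set Y : Matrix σ σ (MvPowerSeries σ ℝ) := Matrix.diagonal y with hY
  set B : Matrix σ σ (MvPowerSeries σ ℝ) := A.map (algebraMap ℝ _) with hB
  set a : σ → MvPowerSeries σ ℝ := fun j => ∑ k, A j k • y k with ha
  -- Differentiating the quadratic form gives two sums, equal by symmetry of `A`; they cancel the
  -- factor 2.
  have hy1 : ∀ i, ∑ k, theta k (y i) - y i = ∑ j, a j * S i j := by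
    intro i
    have h := congrArg (theta i) hC
    rw [Derivation.map_smul, map_sub, map_sum, map_sum] at h
    simp only [map_sum, Derivation.map_smul, Derivation.leibniz, smul_eq_mul, smul_add,
      Finset.sum_add_distrib] at h
    have e1 : ∑ j, ∑ k, A j k • (theta j C * theta i (theta k C)) = ∑ j, a j * S i j := by
      rw [Finset.sum_comm]
      refine Finset.sum_congr rfl fun k _ => ?_
      rw [ha, Finset.sum_mul]
      refine Finset.sum_congr rfl fun j _ => ?_
      rw [hA.apply, smul_mul_assoc, theta_comm i k]
    have e2 : ∑ j, ∑ k, A j k • (theta k C * theta i (theta j C)) = ∑ j, a j * S i j := by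
      refine Finset.sum_congr rfl fun k _ => ?_
      rw [ha, Finset.sum_mul]
      refine Finset.sum_congr rfl fun j _ => ?_
      rw [smul_mul_assoc, theta_comm i k]
    rw [e1, e2, ← two_smul ℝ] at h
    have h' := smul_right_injective _ (two_ne_zero (α := ℝ)) h
    rw [← h']
    simp only [hy, theta_comm i]
  -- The quasilinear equation reads $Vy=y$ along this vector field, whose coefficients depend on
  -- $y$. Differentiating it once more gives the Riccati equation `VS` for the Jacobian `S`.
  set V : Derivation ℝ (MvPowerSeries σ ℝ) (MvPowerSeries σ ℝ) :=
    ∑ j, (1 - a j) • theta j with hV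
  have V_apply : ∀ f, V f = ∑ k, theta k f - ∑ k, a k * theta k f := by
    intro f
    have : V f = ∑ j, (1 - a j) * theta j f := by
      rw [hV, ← Derivation.coeFnAddMonoidHom_apply, map_sum, Finset.sum_apply]
      rfl
    simp only [this, sub_mul, one_mul, Finset.sum_sub_distrib]
  have Vy : ∀ i, V (y i) = y i := by
    intro i
    rw [V_apply, sub_eq_iff_eq_add, ← sub_eq_iff_eq_add', hy1]
  have VS : S.map V = S + S * B * S := by
    ext1 i j
    have h := congrArg (theta j) (Vy i)
    rw [V_apply, map_sub, map_sum, map_sum] at h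
    simp only [Derivation.leibniz, smul_eq_mul, Finset.sum_add_distrib, theta_comm j] at h
    have e : ∑ k, theta k (y i) * theta j (a k) = (S * B * S) i j := by
      rw [Matrix.mul_assoc, Matrix.mul_apply]
      refine Finset.sum_congr rfl fun k _ => ?_
      rw [Matrix.mul_apply, ha, map_sum]
      congr 1
      refine Finset.sum_congr rfl fun l _ => ?_
      rw [Derivation.map_smul, Algebra.smul_def]
      rfl
    rw [e] at h
    rw [Matrix.map_apply, V_apply, Matrix.add_apply]
    linear_combination h
  have VY : Y.map V = Y := by
    rw [hY, Matrix.diagonal_map (map_zero V)]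
    exact congrArg Matrix.diagonal (funext Vy)
  have VB : B.map V = 0 := by
    ext1 i j
    simp [hB]
  -- The target is the matrix identity $S=Y+YBS$. The defect `U` solves a linear homogeneous
  -- equation along `V`, so it vanishes once its degree-one part does.
  set U := S - Y - Y * B * S with hU
  have VU : U.map V = U + U * B * S := by
    have : U.map V = S.map V - Y.map V - (Y * B * S).map V := by
      ext1 i j
      simp [hU]
    rw [this, map_derivation_mul, map_derivation_mul, VS, VY, VB, hU]
    noncomm_ring
  have y0 : ∀ i, MvPowerSeries.coeff 0 (y i) = 0 := by
    intro i
    simp [hy, coeff_theta]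
  have S0 : ∀ i j, MvPowerSeries.coeff 0 (S i j) = 0 := by
    intro i j
    simp [hS, coeff_theta]
  have BS0 : ∀ i j, MvPowerSeries.coeff 0 ((B * S) i j) = 0 := by
    intro i j
    rw [Matrix.mul_apply, map_sum]
    refine Finset.sum_eq_zero fun k _ => ?_
    rw [MvPowerSeries.coeff_mul]
    simp [S0]
  have hU0 : U = 0 := by
    refine eq_zero_of_euler_eq a (B * S) U ?_ BS0 ?_ ?_
    · intro j
      simp [ha, y0]
    -- In degree one `Y * B * S` contributes nothing, both `Y` and `B * S` lacking constant terms.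
    -- There `S` agrees with `Y` because $n_in_j=\delta_{ij}n_i$ when $|n|=1$.
    · intro i j n hn
      have hz : MvPowerSeries.coeff n ((Y * B * S) i j) = 0 := by
        rw [Matrix.mul_assoc, hY, Matrix.diagonal_mul, MvPowerSeries.coeff_mul]
        refine Finset.sum_eq_zero fun kl hkl => ?_
        rw [Finset.HasAntidiagonal.mem_antidiagonal] at hkl
        have hd : kl.1.degree + kl.2.degree = 1 := by rw [← map_add, hkl, hn]
        rcases Nat.eq_zero_or_pos kl.1.degree with h0 | h0
        · rw [(Finsupp.degree_eq_zero_iff _).1 h0, y0, zero_mul]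
        · rw [(Finsupp.degree_eq_zero_iff kl.2).1 (by omega), BS0, mul_zero]
      rw [hU, Matrix.sub_apply, Matrix.sub_apply, map_sub, map_sub, hz, sub_zero, sub_eq_zero, hY,
        Matrix.diagonal_apply]
      split_ifs with hij
      · subst hij
        have hle : n i ≤ 1 := hn ▸ Finsupp.le_degree i n
        simp only [hS, hy, coeff_theta]
        interval_cases n i <;> simp
      · have hle : n i + n j ≤ 1 := by
          rw [← hn, Finsupp.degree_eq_sum, ← Finset.sum_pair hij]
          exact Finset.sum_le_sum_of_subset (Finset.subset_univ _)
        simp only [hS, hy, coeff_theta, map_zero]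
        rcases Nat.eq_zero_or_pos (n i) with h0 | h0
        · simp [h0]
        · simp [show n j = 0 by omega]
    · intro i j
      have h := congrFun (congrFun VU i) j
      rw [Matrix.map_apply, V_apply, Matrix.add_apply, Matrix.mul_assoc] at h
      linear_combination h
  -- Summing a row of $S=Y+YBS$ turns the derivatives $\theta_j$ into the Euler operator $E$.
  have hrow : ∀ j, U i j = 0 := fun j => by rw [hU0]; rfl
  have h := Finset.sum_eq_zero fun j (_ : j ∈ Finset.univ) => hrow j
  simp only [hU, Matrix.sub_apply, Finset.sum_sub_distrib, Matrix.mul_assoc, hY] at h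
  simp only [Matrix.diagonal_mul, ← Finset.mul_sum] at h
  have e1 : ∑ j, Matrix.diagonal y i j = y i := by
    simp [Matrix.diagonal_apply]
  have e2 : ∑ j, (B * S) i j = ∑ j, A i j • ∑ k, theta k (y j) := by
    simp only [Matrix.mul_apply]
    rw [Finset.sum_comm]
    refine Finset.sum_congr rfl fun k _ => ?_
    rw [← Finset.mul_sum, Algebra.smul_def]
    rfl
  rw [e1, e2] at h
  exact sub_eq_zero.1 h

/-- Coefficient form of `euler_theta_eq`. -/
theorem tree_recursion (hA : A.IsSymm) (c : (σ →₀ ℕ) → ℝ)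
    (hc : ∀ n : σ →₀ ℕ, 2 * (((n.degree : ℝ) - 1) * c n) = ∑ kl ∈ Finset.HasAntidiagonal.antidiagonal n,
      (∑ i, ∑ j, A i j * (kl.1 i * kl.2 j)) * (c kl.1 * c kl.2)) (n : σ →₀ ℕ) (i : σ) :
    ((n.degree : ℝ) - 1) * (n i * c n) = ∑ kl ∈ Finset.HasAntidiagonal.antidiagonal n,
      (kl.1 i * c kl.1) * ∑ j, A i j * (kl.2.degree * (kl.2 j * c kl.2)) := by
  have key := euler_theta_eq A (show MvPowerSeries σ ℝ from c) hA ?_ i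
  · have h := congrArg (MvPowerSeries.coeff n) key
    rw [map_sub, coeff_sum_theta, coeff_theta, MvPowerSeries.coeff_mul] at h
    rw [sub_mul, one_mul]
    refine h.trans (Finset.sum_congr rfl fun kl _ => ?_)
    rw [coeff_theta, map_sum]
    congr 1
    refine Finset.sum_congr rfl fun j _ => ?_
    rw [MvPowerSeries.coeff_smul, coeff_sum_theta]
    rfl
  · ext n
    rw [MvPowerSeries.coeff_smul, map_sub, coeff_sum_theta, map_sum]
    have h := hc n
    rw [sub_mul, one_mul] at h
    refine h.trans ?_
    simp only [map_sum, MvPowerSeries.coeff_smul, MvPowerSeries.coeff_mul, Finset.sum_mul,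
      Finset.mul_sum]
    rw [Finset.sum_comm]
    refine Finset.sum_congr rfl fun j _ => ?_
    rw [Finset.sum_comm]
    refine Finset.sum_congr rfl fun k _ => Finset.sum_congr rfl fun kl _ => ?_
    change _ = A j k * (kl.1 j * c kl.1 * (kl.2 k * c kl.2))
    ring

end Formal

/-! ### Power sums with nonnegative summable coefficients -/

section PowerSums

variable {ι : Type*}

theorem exists_nat_mul_pow_le {r : ℝ} (h0 : 0 < r) (h1 : r < 1) :
    ∃ B : ℝ, ∀ n : ℕ, (n : ℝ) * r ^ (n - 1) ≤ B := by
  obtain ⟨B, hB⟩ := (tendsto_self_mul_const_pow_of_lt_one h0.le h1).bddAbove_range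
  refine ⟨B / r, fun n => ?_⟩
  rw [le_div_iff₀ h0]
  refine le_trans (le_of_eq ?_) (hB ⟨n, rfl⟩)
  rcases n with _ | n
  · simp
  · simp [pow_succ, mul_assoc]

theorem summable_mul_nat_mul_pow {b : ι → ℝ} (hb : ∀ n, 0 ≤ b n) (hs : Summable b) (e : ι → ℕ)
    {s : ℝ} (h0 : 0 < s) (h1 : s < 1) :
    Summable fun n => b n * ((e n : ℝ) * s ^ (e n - 1)) := by
  obtain ⟨B, hB⟩ := exists_nat_mul_pow_le h0 h1
  refine Summable.of_nonneg_of_le (fun n => ?_) (fun n => ?_) (hs.mul_right B)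
  · have := hb n
    positivity
  · exact mul_le_mul_of_nonneg_left (hB _) (hb n)

theorem summable_mul_pow {b : ι → ℝ} (hb : ∀ n, 0 ≤ b n) (hs : Summable b) (e : ι → ℕ)
    {s : ℝ} (h0 : 0 ≤ s) (h1 : s ≤ 1) : Summable fun n => b n * s ^ e n :=
  Summable.of_nonneg_of_le (fun n => mul_nonneg (hb n) (pow_nonneg h0 _))
    (fun n => mul_le_of_le_one_right (hb n) (pow_le_one₀ h0 h1)) hs

theorem hasDerivAt_tsum_mul_pow {b : ι → ℝ} (hb : ∀ n, 0 ≤ b n) (hs : Summable b) (e : ι → ℕ)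
    {s : ℝ} (h0 : 0 < s) (h1 : s < 1) :
    HasDerivAt (fun s => ∑' n, b n * s ^ e n) (∑' n, b n * ((e n : ℝ) * s ^ (e n - 1))) s := by
  obtain ⟨r, hsr, hr1⟩ := exists_between h1
  refine hasDerivAt_tsum_of_isPreconnected (t := Set.Ioo 0 r)
    (summable_mul_nat_mul_pow hb hs e (h0.trans hsr) hr1) isOpen_Ioo isPreconnected_Ioo
    (fun n y _ => (hasDerivAt_pow (e n) y).const_mul (b n)) (fun n y hy => ?_) ⟨h0, hsr⟩
    (summable_mul_pow hb hs e h0.le h1.le) ⟨h0, hsr⟩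
  have hy0 := hy.1.le
  have hbn := hb n
  rw [Real.norm_of_nonneg (by positivity)]
  gcongr
  exact hy.2.le

theorem continuousOn_tsum_mul_pow {b : ι → ℝ} (hb : ∀ n, 0 ≤ b n) (hs : Summable b) (e : ι → ℕ) :
    ContinuousOn (fun s => ∑' n, b n * s ^ e n) (Set.Icc (0 : ℝ) 1) := by
  refine continuousOn_tsum (fun n => by fun_prop) hs fun n s h => ?_
  rw [Real.norm_of_nonneg (mul_nonneg (hb n) (pow_nonneg h.1 _))]
  exact mul_le_of_le_one_right (hb n) (pow_le_one₀ h.1 h.2)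

end PowerSums

/-! ### Mass bound and functional equation of the generating function -/

section Mass

open Finset.HasAntidiagonal

variable {σ : Type*} [Fintype σ]

/-- Evaluates $g_i(s)/s$ at $s=0$. With truncated subtraction $0^{|n|-1}=1$ for both $|n|=1$ and
$|n|=0$, but the factor $n_i$ removes $n=0$. -/
theorem apply_mul_zero_pow_degree [DecidableEq σ] (n : σ →₀ ℕ) (i : σ) :
    (n i : ℝ) * 0 ^ (n.degree - 1) = if n = Finsupp.single i 1 then 1 else 0 := by
  split_ifs with h
  · simp [h]
  · rcases Nat.lt_or_ge 1 n.degree with hn | hn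
    · rw [zero_pow (by omega), mul_zero]
    · rcases Nat.eq_zero_or_pos (n i) with h0 | h0
      · simp [h0]
      · have hle := Finsupp.le_degree i n
        refine absurd ?_ h
        have hsum := Finsupp.degree_eq_sum n
        rw [← Finset.add_sum_erase _ _ (Finset.mem_univ i)] at hsum
        have hz : ∑ j ∈ Finset.univ.erase i, n j = 0 := by omega
        ext j
        rcases eq_or_ne j i with rfl | hj
        · rw [Finsupp.single_eq_same]
          omega
        · rw [Finsupp.single_eq_of_ne hj]
          exact Finset.sum_eq_zero_iff.1 hz j (Finset.mem_erase.2 ⟨hj, Finset.mem_univ j⟩)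

/-- A size distribution satisfying the recursion for tree weights, with unit-vector masses as for
the reduced equation at time `t`. -/
structure IsTreeDistribution [DecidableEq σ] (A : Matrix σ σ ℝ) (p : σ → ℝ) (t : ℝ)
    (w : (σ →₀ ℕ) → ℝ) : Prop where
  nonneg : ∀ n, 0 ≤ w n
  recursion : ∀ n i, ((n.degree : ℝ) - 1) * (n i * w n) = t * ∑ kl ∈ antidiagonal n,
      (kl.1 i * w kl.1) * ∑ j, A i j * (kl.2.degree * (kl.2 j * w kl.2))
  single : ∀ i, w (Finsupp.single i 1) = p i * Real.exp (-(t * A.mulVec p i))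

/-- The mass generating function `∑_n n_i w_n s^{|n|}` of a size distribution. -/
noncomputable def massSeries (w : (σ →₀ ℕ) → ℝ) (s : ℝ) (i : σ) : ℝ :=
  ∑' n : σ →₀ ℕ, (n i * w n) * s ^ n.degree

namespace IsTreeDistribution

variable [DecidableEq σ] {A : Matrix σ σ ℝ} {p : σ → ℝ} {t : ℝ} {w : (σ →₀ ℕ) → ℝ}

theorem mul_nonneg' (h : IsTreeDistribution A p t w) (n : σ →₀ ℕ) (i : σ) : 0 ≤ n i * w n :=
  mul_nonneg (Nat.cast_nonneg _) (h.nonneg n)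

/-- The recursion, weighted with powers of `s` as in the derivative of the generating function. -/
theorem recursion_pow (h : IsTreeDistribution A p t w) (s : ℝ) (n : σ →₀ ℕ) (i : σ) :
    n i * w n * (((n.degree - 1 : ℕ) : ℝ) * s ^ (n.degree - 1 - 1)) =
      t * ∑ kl ∈ antidiagonal n, (kl.1 i * w kl.1 * s ^ (kl.1.degree - 1)) *
        ∑ j, A i j * (kl.2 j * w kl.2 * (kl.2.degree * s ^ (kl.2.degree - 1))) := by
  rcases Nat.eq_zero_or_pos n.degree with h0 | h0
  · rw [Finsupp.degree_eq_zero_iff] at h0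
    simp [h0]
  have e : n i * w n * (((n.degree - 1 : ℕ) : ℝ) * s ^ (n.degree - 1 - 1))
      = (((n.degree : ℝ) - 1) * (n i * w n)) * s ^ (n.degree - 1 - 1) := by
    rw [Nat.cast_sub h0, Nat.cast_one]
    ring
  rw [e, h.recursion, mul_assoc, Finset.sum_mul]
  congr 1
  refine Finset.sum_congr rfl fun kl hkl => ?_
  rw [mem_antidiagonal] at hkl
  rcases Nat.eq_zero_or_pos kl.1.degree with h1 | h1
  · rw [Finsupp.degree_eq_zero_iff] at h1
    simp [h1]
  rcases Nat.eq_zero_or_pos kl.2.degree with h2 | h2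
  · rw [Finsupp.degree_eq_zero_iff] at h2
    simp [h2]
  have hd : n.degree - 1 - 1 = (kl.1.degree - 1) + (kl.2.degree - 1) := by
    rw [← hkl, map_add]
    omega
  rw [hd, pow_add]
  simp only [Finset.mul_sum, Finset.sum_mul]
  refine Finset.sum_congr rfl fun j _ => ?_
  ring

/-- The masses of the clusters of size at most `N` are bounded by `p`. -/
theorem sum_degree_le (h : IsTreeDistribution A p t w) (hA : ∀ i j, 0 ≤ A i j)
    (hp : ∀ i, 0 ≤ p i) (ht : 0 ≤ t) (N : ℕ) (i : σ) :
    ∑ n ∈ (Finsupp.finite_of_degree_le (σ := σ) N).toFinset, n i * w n ≤ p i := by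
  set F : ℕ → Finset (σ →₀ ℕ) := fun N => (Finsupp.finite_of_degree_le (σ := σ) N).toFinset with hF
  have mem_F : ∀ N n, n ∈ F N ↔ n.degree ≤ N := fun N n => by simp [hF]
  induction N generalizing i with
  | zero =>
    refine le_trans (le_of_eq (Finset.sum_eq_zero fun n hn => ?_)) (hp i)
    have := (mem_F 0 n).1 hn
    rw [Nat.le_zero, Finsupp.degree_eq_zero_iff] at this
    simp [this]
  | succ N ih =>
    set φ : ℝ → ℝ := fun s => ∑ n ∈ F (N + 1), (n i * w n) * s ^ (n.degree - 1) with hφ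
    set ψ : ℝ → ℝ := fun s => ∑ j, A i j * ∑ n ∈ F N, (n j * w n) * s ^ n.degree with hψ
    set φ' : ℝ → ℝ := fun s => ∑ n ∈ F (N + 1),
      n i * w n * (((n.degree - 1 : ℕ) : ℝ) * s ^ (n.degree - 1 - 1)) with hφ'
    set ψ' : ℝ → ℝ := fun s => ∑ j, A i j * ∑ n ∈ F N,
      n j * w n * (n.degree * s ^ (n.degree - 1)) with hψ'
    have dφ : ∀ s, HasDerivAt φ (φ' s) s := fun s =>
      HasDerivAt.fun_sum fun n _ => (hasDerivAt_pow (n.degree - 1) s).const_mul _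
    have dψ : ∀ s, HasDerivAt ψ (ψ' s) s := fun s =>
      HasDerivAt.fun_sum fun j _ => (HasDerivAt.fun_sum fun n _ =>
        (hasDerivAt_pow n.degree s).const_mul _).const_mul _
    -- In the convolution the term $k=0$ vanishes, so $|k+l|\le N+1$ forces $|l|\le N$. Hence `ψ`
    -- may be truncated one level lower than `φ`, which makes the induction work.
    have hle : ∀ s, 0 ≤ s → φ' s ≤ t * (φ s * ψ' s) := by
      intro s hs
      set g : (σ →₀ ℕ) → ℝ := fun k => k i * w k * s ^ (k.degree - 1) with hg
      set f : (σ →₀ ℕ) → ℝ := fun l =>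
        ∑ j, A i j * (l j * w l * (l.degree * s ^ (l.degree - 1))) with hf
      have g0 : ∀ k, 0 ≤ g k := fun k => mul_nonneg (h.mul_nonneg' k i) (pow_nonneg hs _)
      have f0 : ∀ l, 0 ≤ f l := fun l => Finset.sum_nonneg fun j _ =>
        mul_nonneg (hA i j) (mul_nonneg (h.mul_nonneg' l j) (by positivity))
      have e1 : φ' s = t * ∑ n ∈ F (N + 1), ∑ kl ∈ antidiagonal n, g kl.1 * f kl.2 := by
        rw [Finset.mul_sum]
        exact Finset.sum_congr rfl fun n _ => h.recursion_pow s n i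
      have e2 : ψ' s = ∑ l ∈ F N, f l := by
        simp only [hψ', hf, Finset.mul_sum]
        rw [Finset.sum_comm]
      rw [e1, e2, hφ, Finset.sum_mul_sum, ← Finset.sum_product']
      refine mul_le_mul_of_nonneg_left ?_ ht
      rw [← Finset.sum_biUnion, ← Finset.sum_filter_ne_zero]
      · refine Finset.sum_le_sum_of_subset_of_nonneg (fun kl hkl => ?_)
          fun kl _ _ => mul_nonneg (g0 _) (f0 _)
        rw [Finset.mem_filter, Finset.mem_biUnion] at hkl
        obtain ⟨⟨n, hn, hkl⟩, hne⟩ := hkl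
        rw [mem_antidiagonal] at hkl
        rw [mem_F, ← hkl, map_add] at hn
        have h1 : kl.1.degree ≠ 0 := by
          intro h1
          rw [Finsupp.degree_eq_zero_iff] at h1
          exact hne (by simp [hg, h1])
        rw [Finset.mem_product, mem_F, mem_F]
        omega
      · intro n _ n' _ hnn
        rw [Function.onFun, Finset.disjoint_left]
        intro kl h1 h2
        rw [mem_antidiagonal] at h1 h2
        exact hnn (h1.symm.trans h2)
    have anti : AntitoneOn (fun s => φ s * Real.exp (-(t * ψ s))) (Set.Icc 0 1) := by
      have hd : ∀ s, HasDerivAt (fun s => φ s * Real.exp (-(t * ψ s)))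
          (φ' s * Real.exp (-(t * ψ s)) + φ s * (Real.exp (-(t * ψ s)) * -(t * ψ' s))) s :=
        fun s => (dφ s).mul (((dψ s).const_mul t).neg.exp)
      refine antitoneOn_of_deriv_nonpos (convex_Icc 0 1)
        (fun s _ => (hd s).continuousAt.continuousWithinAt)
        (fun s _ => (hd s).differentiableAt.differentiableWithinAt) fun s hs => ?_
      rw [interior_Icc] at hs
      rw [(hd s).deriv]
      have := mul_le_mul_of_nonneg_right (hle s hs.1.le) (Real.exp_pos (-(t * ψ s))).le
      linarith
    have hmono := anti (Set.left_mem_Icc.2 zero_le_one) (Set.right_mem_Icc.2 zero_le_one)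
      zero_le_one
    have φ0 : φ 0 = p i * Real.exp (-(t * A.mulVec p i)) := by
      rw [← h.single, hφ]
      refine (Finset.sum_eq_single (Finsupp.single i 1) (fun n _ hn => ?_) fun hn => ?_).trans ?_
      · rw [mul_right_comm, apply_mul_zero_pow_degree, if_neg hn, zero_mul]
      · refine absurd ((mem_F _ _).2 ?_) hn
        simp
      · simp
    have ψ0 : ψ 0 = 0 := by
      refine Finset.sum_eq_zero fun j _ => ?_
      rw [Finset.sum_eq_zero, mul_zero]
      intro n _
      rcases Nat.eq_zero_or_pos n.degree with h0 | h0
      · rw [Finsupp.degree_eq_zero_iff] at h0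
        simp [h0]
      · rw [zero_pow h0.ne', mul_zero]
    have φ1 : φ 1 = ∑ n ∈ F (N + 1), n i * w n := by simp [hφ]
    -- The induction hypothesis makes the exponential gain $e^{t\psi(1)}$ at most the initial loss
    -- $e^{-t(Ap)_i}$ can absorb.
    have ψ1 : ψ 1 ≤ A.mulVec p i := by
      simp only [hψ, one_pow, mul_one]
      exact Finset.sum_le_sum fun j _ => mul_le_mul_of_nonneg_left (ih j) (hA i j)
    simp only [φ0, ψ0, mul_zero, neg_zero, Real.exp_zero, mul_one] at hmono
    rw [φ1, ← le_div_iff₀ (Real.exp_pos _), mul_div_assoc, ← Real.exp_sub] at hmono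
    refine hmono.trans (mul_le_of_le_one_right (hp i) ?_)
    rw [Real.exp_le_one_iff]
    have := mul_le_mul_of_nonneg_left ψ1 ht
    linarith

theorem sum_le (h : IsTreeDistribution A p t w) (hA : ∀ i j, 0 ≤ A i j)
    (hp : ∀ i, 0 ≤ p i) (ht : 0 ≤ t) (i : σ) (u : Finset (σ →₀ ℕ)) :
    ∑ n ∈ u, n i * w n ≤ p i := by
  refine le_trans (Finset.sum_le_sum_of_subset_of_nonneg (fun n hn => ?_)
    fun n _ _ => h.mul_nonneg' n i) (h.sum_degree_le hA hp ht (u.sup Finsupp.degree) i)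
  simpa using Finset.le_sup (f := Finsupp.degree) hn

theorem summable (h : IsTreeDistribution A p t w) (hA : ∀ i j, 0 ≤ A i j)
    (hp : ∀ i, 0 ≤ p i) (ht : 0 ≤ t) (i : σ) : Summable fun n : σ →₀ ℕ => n i * w n :=
  summable_of_sum_le (fun n => h.mul_nonneg' n i) (h.sum_le hA hp ht i)

theorem massSeries_le (h : IsTreeDistribution A p t w) (hA : ∀ i j, 0 ≤ A i j)
    (hp : ∀ i, 0 ≤ p i) (ht : 0 ≤ t) {s : ℝ} (h0 : 0 ≤ s) (h1 : s ≤ 1) (i : σ) :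
    massSeries w s i ≤ p i := by
  refine le_trans (Summable.tsum_le_tsum (fun n => ?_)
    (summable_mul_pow (fun n => h.mul_nonneg' n i) (h.summable hA hp ht i) _ h0 h1)
    (h.summable hA hp ht i))
    (Real.tsum_le_of_sum_le (fun n => h.mul_nonneg' n i) (h.sum_le hA hp ht i))
  exact mul_le_of_le_one_right (h.mul_nonneg' n i) (pow_le_one₀ h0 h1)

theorem continuousOn_massSeries (h : IsTreeDistribution A p t w) (hA : ∀ i j, 0 ≤ A i j)
    (hp : ∀ i, 0 ≤ p i) (ht : 0 ≤ t) (i : σ) :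
    ContinuousOn (fun s => massSeries w s i) (Set.Icc 0 1) :=
  continuousOn_tsum_mul_pow (fun n => h.mul_nonneg' n i) (h.summable hA hp ht i) _

/-- The functional equation of the mass generating function. -/
theorem massSeries_eq (h : IsTreeDistribution A p t w) (hA : ∀ i j, 0 ≤ A i j)
    (hp : ∀ i, 0 ≤ p i) (ht : 0 ≤ t) {s : ℝ} (h0 : 0 ≤ s) (h1 : s ≤ 1) (i : σ) :
    massSeries w s i = s * (p i * Real.exp (-(t * A.mulVec (fun j => p j - massSeries w s j) i))) := by
  have hs := h.summable hA hp ht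
  have hn := fun j => fun n => h.mul_nonneg' n j
  set φ : ℝ → ℝ := fun s => ∑' n : σ →₀ ℕ, (n i * w n) * s ^ (n.degree - 1) with hφ
  set ψ : ℝ → ℝ := fun s => ∑ j, A i j * massSeries w s j with hψ
  have hmass : massSeries w s i = s * φ s := by
    rw [hφ, massSeries, ← tsum_mul_left]
    refine tsum_congr fun n => ?_
    rcases Nat.eq_zero_or_pos n.degree with hd | hd
    · rw [Finsupp.degree_eq_zero_iff] at hd
      simp [hd]
    · obtain ⟨d, hd⟩ := Nat.exists_eq_add_of_lt hd
      rw [hd, zero_add, Nat.add_sub_cancel, pow_succ]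
      ring
  have φ0 : φ 0 = p i * Real.exp (-(t * A.mulVec p i)) := by
    rw [← h.single, hφ]
    refine (tsum_eq_single (Finsupp.single i 1) fun n hn => ?_).trans ?_
    · rw [mul_right_comm, apply_mul_zero_pow_degree, if_neg hn, zero_mul]
    · simp
  have ψ0 : ψ 0 = 0 := by
    refine Finset.sum_eq_zero fun j _ => ?_
    rw [massSeries]
    convert mul_zero _
    convert! tsum_zero with n
    rcases Nat.eq_zero_or_pos n.degree with hd | hd
    · rw [Finsupp.degree_eq_zero_iff] at hd
      simp [hd]
    · rw [zero_pow hd.ne', mul_zero]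
  -- The recursion becomes $\varphi'=t\varphi\psi'$ by a Cauchy product, so this quantity has zero
  -- derivative inside $(0,s)$. Continuity up to the endpoints covers $s=1$, where differentiability
  -- is not available.
  have key : φ s * Real.exp (-(t * ψ s)) = φ 0 := by
    rcases h0.eq_or_lt with rfl | hs0
    · rw [ψ0, mul_zero, neg_zero, Real.exp_zero, mul_one]
    have hsub : Set.Icc 0 s ⊆ Set.Icc (0 : ℝ) 1 := Set.Icc_subset_Icc_right h1
    have cψ : ContinuousOn ψ (Set.Icc 0 1) := continuousOn_finsetSum _ fun j _ =>
      continuousOn_const.mul (h.continuousOn_massSeries hA hp ht j)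
    have hc : ContinuousOn (fun s => φ s * Real.exp (-(t * ψ s))) (Set.Icc 0 s) :=
      ((continuousOn_tsum_mul_pow (hn i) (hs i) _).mul
        (continuousOn_const.mul cψ).neg.rexp).mono hsub
    have hd : ∀ x ∈ Set.Ioo 0 s, HasDerivAt (fun s => φ s * Real.exp (-(t * ψ s))) 0 x := by
      intro x hx
      have hx0 := hx.1
      have hx1 : x < 1 := hx.2.trans_le h1
      set ψ' := ∑ j, A i j * ∑' n : σ →₀ ℕ, n j * w n * (n.degree * x ^ (n.degree - 1)) with hψ'
      have dψ : HasDerivAt ψ ψ' x := HasDerivAt.fun_sum fun j _ =>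
        (hasDerivAt_tsum_mul_pow (hn j) (hs j) _ hx0 hx1).const_mul _
      have dφ : HasDerivAt φ (t * (φ x * ψ')) x := by
        convert! hasDerivAt_tsum_mul_pow (hn i) (hs i) (fun n => n.degree - 1) hx0 hx1 using 1
        rw [tsum_congr fun n => h.recursion_pow x n i, tsum_mul_left]
        have sj : ∀ j, Summable fun n : σ →₀ ℕ => n j * w n * (n.degree * x ^ (n.degree - 1)) :=
          fun j => summable_mul_nat_mul_pow (hn j) (hs j) _ hx0 hx1
        have sf : Summable fun l : σ →₀ ℕ =>
            ∑ j, A i j * (l j * w l * (l.degree * x ^ (l.degree - 1))) :=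
          summable_sum fun j _ => (sj j).mul_left _
        have sg : Summable fun k : σ →₀ ℕ => k i * w k * x ^ (k.degree - 1) :=
          summable_mul_pow (hn i) (hs i) _ hx0.le hx1.le
        have e : ψ' = ∑' l : σ →₀ ℕ,
            ∑ j, A i j * (l j * w l * (l.degree * x ^ (l.degree - 1))) := by
          rw [Summable.tsum_finsetSum fun j _ => (sj j).mul_left _]
          exact Finset.sum_congr rfl fun j _ => tsum_mul_left.symm
        rw [e, hφ]
        congr 1
        refine sg.tsum_mul_tsum_eq_tsum_sum_antidiagonal sf (sg.mul_of_nonneg sf ?_ ?_)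
        · intro k
          exact mul_nonneg (hn i k) (pow_nonneg hx0.le _)
        · intro l
          exact Finset.sum_nonneg fun j _ =>
            mul_nonneg (hA i j) (mul_nonneg (hn j l) (by positivity))
      refine (dφ.mul ((dψ.const_mul t).neg.exp)).congr_deriv ?_
      ring
    obtain ⟨c, _, hc⟩ := exists_hasDerivAt_eq_slope _ (fun _ => 0) hs0 hc hd
    rw [eq_comm, div_eq_zero_iff] at hc
    have := hc.resolve_right (by linarith)
    rw [ψ0, mul_zero, neg_zero, Real.exp_zero, mul_one] at this
    linarith
  have hφs : φ s = p i * Real.exp (-(t * A.mulVec (fun j => p j - massSeries w s j) i)) := by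
    rw [← mul_right_cancel_iff_of_pos (Real.exp_pos (-(t * ψ s))), key, φ0, mul_assoc,
      ← Real.exp_add]
    congr 2
    have : A.mulVec (fun j => p j - massSeries w s j) i = A.mulVec p i - ψ s := by
      simp only [hψ, Matrix.mulVec, dotProduct, mul_sub, Finset.sum_sub_distrib]
    rw [this]
    ring
  rw [hmass, hφs]

end IsTreeDistribution

end Mass

/-! ### Spectral radius of nonnegative matrices and the mean matrix -/

section Spectral

attribute [local instance] Matrix.linftyOpNormedRing Matrix.linftyOpNormedAlgebra

variable {m : ℕ}

theorem spectralRadius_ne_top (M : Matrix (Fin m) (Fin m) ℂ) : spectralRadius ℂ M ≠ ⊤ := by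
  have h := spectrum.spectralRadius_le_pow_nnnorm_pow_one_div ℂ M 0
  refine ne_top_of_le_ne_top ?_ h
  simp [ENNReal.mul_eq_top]

theorem norm_le_specRadius (M : Matrix (Fin m) (Fin m) ℝ) {μ : ℂ}
    (h : μ ∈ spectrum ℂ (M.map (algebraMap ℝ ℂ))) : ‖μ‖ ≤ specRadius M := by
  have hle : (‖μ‖₊ : ENNReal) ≤ spectralRadius ℂ (M.map (algebraMap ℝ ℂ)) :=
    le_iSup₂ (f := fun k (_ : k ∈ spectrum ℂ (M.map (algebraMap ℝ ℂ))) => (‖k‖₊ : ENNReal)) μ h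
  exact ENNReal.toReal_mono (spectralRadius_ne_top _) hle

theorem exists_norm_eq_specRadius [NeZero m] (M : Matrix (Fin m) (Fin m) ℝ) :
    ∃ μ ∈ spectrum ℂ (M.map (algebraMap ℝ ℂ)), ‖μ‖ = specRadius M := by
  have : CompleteSpace (Matrix (Fin m) (Fin m) ℂ) := FiniteDimensional.complete ℂ _
  obtain ⟨μ, hμ, h⟩ := spectrum.exists_nnnorm_eq_spectralRadius (M.map (algebraMap ℝ ℂ))
  refine ⟨μ, hμ, ?_⟩
  rw [specRadius, ← h]
  rfl

theorem specRadius_nonneg (M : Matrix (Fin m) (Fin m) ℝ) : 0 ≤ specRadius M :=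
  ENNReal.toReal_nonneg

theorem specRadius_smul [NeZero m] (M : Matrix (Fin m) (Fin m) ℝ) {t : ℝ} (ht : 0 ≤ t) :
    specRadius (t • M) = t * specRadius M := by
  have : CompleteSpace (Matrix (Fin m) (Fin m) ℂ) := FiniteDimensional.complete ℂ _
  have hmap : (t • M).map (algebraMap ℝ ℂ) = (t : ℂ) • M.map (algebraMap ℝ ℂ) := by
    ext i j
    simp
  have hspec := spectrum.smul_eq_smul (t : ℂ) (M.map (algebraMap ℝ ℂ)) (spectrum.nonempty _)
  have hn : ∀ μ : ℂ, ‖(t : ℂ) • μ‖ = t * ‖μ‖ := fun μ => by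
    rw [norm_smul, Complex.norm_real, Real.norm_of_nonneg ht]
  apply le_antisymm
  · obtain ⟨μ, hμ, h⟩ := exists_norm_eq_specRadius (t • M)
    rw [hmap, hspec] at hμ
    obtain ⟨ν, hν, rfl⟩ := hμ
    rw [← h]
    refine (hn ν).le.trans ?_
    exact mul_le_mul_of_nonneg_left (norm_le_specRadius M hν) ht
  · obtain ⟨μ, hμ, h⟩ := exists_norm_eq_specRadius M
    rw [← h, ← hn]
    refine norm_le_specRadius _ ?_
    rw [hmap, hspec]
    exact Set.smul_mem_smul_set hμ

/-- By Gelfand's formula $\|M^k\|\le r^k$ eventually, for any $r$ strictly between the spectral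
radius and 1; the norm dominates each entry. -/
theorem tendsto_pow_of_specRadius_lt_one (M : Matrix (Fin m) (Fin m) ℝ) (h : specRadius M < 1)
    (i j : Fin m) : Filter.Tendsto (fun k => (M ^ k) i j) Filter.atTop (nhds 0) := by
  have : CompleteSpace (Matrix (Fin m) (Fin m) ℂ) := FiniteDimensional.complete ℂ _
  obtain ⟨r, hr, hr1⟩ := exists_between h
  have hr0 : 0 < r := (specRadius_nonneg M).trans_lt hr
  set N := M.map (algebraMap ℝ ℂ) with hN
  have hlt : spectralRadius ℂ N < ENNReal.ofReal r :=
    (ENNReal.lt_ofReal_iff_toReal_lt (spectralRadius_ne_top N)).2 hr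
  have hev := (spectrum.pow_norm_pow_one_div_tendsto_nhds_spectralRadius N).eventually_lt_const hlt
  have hentry : ∀ k, ‖(M ^ k) i j‖ ≤ ‖N ^ k‖ := by
    intro k
    have e : N ^ k = (M ^ k).map (algebraMap ℝ ℂ) := (Matrix.map_pow M (algebraMap ℝ ℂ) k).symm
    have e' : ‖(M ^ k) i j‖ = ‖(N ^ k) i j‖ := by
      rw [e, Matrix.map_apply, norm_algebraMap']
    rw [e', Matrix.linfty_opNorm_def]
    have h1 : ‖(N ^ k) i j‖₊ ≤ ∑ j, ‖(N ^ k) i j‖₊ :=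
      Finset.single_le_sum (f := fun j => ‖(N ^ k) i j‖₊) (fun _ _ => zero_le) (Finset.mem_univ j)
    exact_mod_cast h1.trans (Finset.le_sup (f := fun i => ∑ j, ‖(N ^ k) i j‖₊) (Finset.mem_univ i))
  refine squeeze_zero_norm' ?_ (tendsto_pow_atTop_nhds_zero_of_lt_one hr0.le hr1)
  filter_upwards [hev, Filter.eventually_gt_atTop 0] with k hk hk0
  refine (hentry k).trans ?_
  have h1 := ((ENNReal.ofReal_lt_ofReal_iff hr0).1 hk).le
  have h2 := pow_le_pow_left₀ (by positivity) h1 k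
  rwa [← Real.rpow_natCast, ← Real.rpow_mul (norm_nonneg _), one_div_mul_cancel (by positivity),
    Real.rpow_one] at h2

/-- A matrix with nonnegative entries has a nonnegative subinvariant vector for its spectral
radius. -/
theorem exists_subinvariant [NeZero m] (M : Matrix (Fin m) (Fin m) ℝ) (hM : ∀ i j, 0 ≤ M i j) :
    ∃ u : Fin m → ℝ, (∀ i, 0 ≤ u i) ∧ u ≠ 0 ∧ ∀ i, specRadius M * u i ≤ M.mulVec u i := by
  obtain ⟨μ, hμ, h⟩ := exists_norm_eq_specRadius M
  rw [← Matrix.spectrum_toLin', ← Module.End.hasEigenvalue_iff_mem_spectrum] at hμ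
  obtain ⟨v, hv⟩ := hμ.exists_hasEigenvector
  -- Take entrywise moduli of an eigenvector for an eigenvalue of maximal modulus and apply the
  -- triangle inequality.
  refine ⟨fun i => ‖v i‖, fun i => norm_nonneg _, fun h0 => hv.2 ?_, fun i => ?_⟩
  · ext i
    exact norm_eq_zero.1 (congrFun h0 i)
  · have e := congrFun hv.apply_eq_smul i
    rw [Matrix.toLin'_apply, Pi.smul_apply] at e
    rw [← h, ← norm_mul, ← smul_eq_mul, ← e]
    change ‖∑ j, (M.map (algebraMap ℝ ℂ)) i j * v j‖ ≤ ∑ j, M i j * ‖v j‖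
    refine (norm_sum_le _ _).trans (Finset.sum_le_sum fun j _ => ?_)
    rw [norm_mul, Matrix.map_apply, norm_algebraMap', Real.norm_of_nonneg (hM i j)]

/-- A closed walk $i\to j\to i$ of positive weight keeps a diagonal entry of the even powers bounded
below after rescaling, whereas a zero spectral radius would survive any rescaling and force the
powers to tend to 0. The case $i=j$ is included. -/
theorem specRadius_pos [NeZero m] (M : Matrix (Fin m) (Fin m) ℝ) (hM : ∀ i j, 0 ≤ M i j)
    {i j : Fin m} (hij : 0 < M i j) (hji : 0 < M j i) : 0 < specRadius M := by
  by_contra hcon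
  have h0 : specRadius M = 0 := le_antisymm (not_lt.1 hcon) (specRadius_nonneg M)
  set a := M i j * M j i with ha
  have ha0 : 0 < a := mul_pos hij hji
  -- Chosen so that $c^2a\ge1$, that is, the rescaled two-step return weight is at least 1.
  set c := 1 + 1 / a with hc
  have hc1 : 1 ≤ c := by rw [hc]; have := one_div_pos.2 ha0; linarith
  have hca : 1 ≤ c ^ 2 * a := by
    have h1 : c ≤ c ^ 2 := by nlinarith
    have h2 : c * a = a + 1 := by rw [hc]; field_simp
    nlinarith
  have hpos : ∀ k : ℕ, (∀ x y, 0 ≤ ((c • M) ^ k) x y) := by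
    intro k
    induction k with
    | zero => intro x y; rw [pow_zero, Matrix.one_apply]; split_ifs <;> norm_num
    | succ k ih =>
      intro x y
      rw [pow_succ, Matrix.mul_apply]
      exact Finset.sum_nonneg fun z _ =>
        mul_nonneg (ih x z) (mul_nonneg (by linarith) (hM z y))
  have hge : ∀ k : ℕ, 1 ≤ ((c • M) ^ (2 * k)) i i := by
    intro k
    induction k with
    | zero => simp
    | succ k ih =>
      have h2 : c ^ 2 * a ≤ ((c • M) ^ 2) i i := by
        rw [pow_two (c • M), Matrix.mul_apply]
        refine le_trans (le_of_eq ?_) (Finset.single_le_sum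
          (f := fun z => (c • M) i z * (c • M) z i) (fun z _ => ?_) (Finset.mem_univ j))
        · simp only [Matrix.smul_apply, smul_eq_mul]
          ring
        · have := hpos 1
          rw [pow_one] at this
          exact mul_nonneg (this _ _) (this _ _)
      rw [mul_add, mul_one, pow_add, Matrix.mul_apply]
      refine le_trans ?_ (Finset.single_le_sum (f := fun z => ((c • M) ^ (2 * k)) i z *
        ((c • M) ^ 2) z i) (fun z _ => mul_nonneg (hpos _ _ _) (hpos _ _ _)) (Finset.mem_univ i))
      exact one_le_mul_of_one_le_of_one_le ih (hca.trans h2)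
  have ht := tendsto_pow_of_specRadius_lt_one (c • M)
    (by rw [specRadius_smul M (by linarith), h0, mul_zero]; exact one_pos) i i
  have ht2 := ht.comp (Filter.tendsto_id.const_mul_atTop' (two_pos (α := ℕ)))
  exact absurd (ge_of_tendsto' ht2 hge) (by norm_num)

theorem integral_poissonMeasure_id (r : NNReal) : ∫ n : ℕ, (n : ℝ) ∂(poissonMeasure r) = r := by
  rw [integral_poissonMeasure]
  have h := (hasSum_one_poissonMeasure r).mul_left (r : ℝ)
  have h1 : HasSum (fun n : ℕ => (Real.exp (-r) * r ^ n / n.factorial) • (n : ℝ)) (r : ℝ) := by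
    rw [← hasSum_nat_add_iff' 1]
    convert! h using 1
    · ext n
      rw [Nat.factorial_succ, pow_succ, smul_eq_mul]
      push_cast
      field_simp
    · simp
  exact h1.tsum_eq

theorem meanMatrix_assocProcess (A : Matrix (Fin m) (Fin m) ℝ) (hA : ∀ i j, 0 ≤ A i j)
    (p : Fin m → ℝ) (hp : ∀ i, 0 ≤ p i) (hp1 : ∑ i, p i = 1) {t : ℝ} (ht : 0 ≤ t) :
    (assocProcess A p hp hp1 t).meanMatrix = t • (A * Matrix.diagonal p) := by
  ext i j
  change ∫ x, ((x j : ℕ) : ℝ) ∂(Measure.pi fun l => poissonMeasure (t * A i l * p l).toNNReal) = _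
  rw [integral_comp_eval (μ := fun l => poissonMeasure (t * A i l * p l).toNNReal)
    (f := fun n : ℕ => (n : ℝ)) .of_discrete, integral_poissonMeasure_id,
    Real.coe_toNNReal _ (mul_nonneg (mul_nonneg ht (hA i j)) (hp j)), Matrix.smul_apply,
    Matrix.mul_diagonal, smul_eq_mul, mul_assoc]

end Spectral

open Finset.HasAntidiagonal

variable {m : ℕ} {A : Matrix (Fin m) (Fin m) ℝ} {p : Fin m → ℝ}

/-! ### Mass conservation below criticality and mass loss above it -/

section Phase

variable {t : ℝ} {w : (Fin m →₀ ℕ) → ℝ}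

/-- From $1-e^{-x}\le x$ the deficit $d=p-g(1)$ satisfies $d\le N^Td$ with $N=tAP$, by symmetry of
`A`. Iterating gives $d\le(N^T)^kd\to0$. -/
theorem IsTreeDistribution.massSeries_one_eq (h : IsTreeDistribution A p t w) (hsymm : A.IsSymm)
    (hA : ∀ i j, 0 ≤ A i j) (hp : ∀ i, 0 ≤ p i) (ht : 0 ≤ t)
    (hsub : specRadius (t • (A * Matrix.diagonal p)) < 1) : massSeries w 1 = p := by
  set d : Fin m → ℝ := fun i => p i - massSeries w 1 i with hd
  set N := t • (A * Matrix.diagonal p) with hN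
  have hN0 : ∀ i j, 0 ≤ N i j := fun i j => by
    rw [hN, Matrix.smul_apply, Matrix.mul_diagonal, smul_eq_mul]
    exact mul_nonneg ht (mul_nonneg (hA i j) (hp j))
  have hd1 : ∀ i, d i ≤ ∑ j, N j i * d j := by
    intro i
    have e := h.massSeries_eq hA hp ht zero_le_one le_rfl i
    have h1 := Real.add_one_le_exp (-(t * A.mulVec d i))
    have h2 := mul_le_mul_of_nonneg_left h1 (hp i)
    have h3 : d i ≤ t * p i * A.mulVec d i := by
      rw [one_mul] at e
      change p i - massSeries w 1 i ≤ _
      rw [e]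
      linarith
    refine h3.trans (le_of_eq ?_)
    rw [Matrix.mulVec, dotProduct, Finset.mul_sum]
    refine Finset.sum_congr rfl fun j _ => ?_
    rw [hN, Matrix.smul_apply, Matrix.mul_diagonal, smul_eq_mul, hsymm.apply]
    ring
  have hdk : ∀ k : ℕ, ∀ i, d i ≤ ∑ j, (N ^ k) j i * d j := by
    intro k
    induction k with
    | zero =>
      intro i
      simp [Matrix.one_apply]
    | succ k ih =>
      intro i
      refine (hd1 i).trans ?_
      calc ∑ j, N j i * d j ≤ ∑ j, N j i * ∑ l, (N ^ k) l j * d l :=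
            Finset.sum_le_sum fun j _ => mul_le_mul_of_nonneg_left (ih j) (hN0 j i)
        _ = ∑ l, (N ^ (k + 1)) l i * d l := by
            simp only [pow_succ, Matrix.mul_apply, Finset.mul_sum, Finset.sum_mul]
            rw [Finset.sum_comm]
            refine Finset.sum_congr rfl fun l _ => Finset.sum_congr rfl fun j _ => ?_
            ring
  ext i
  refine le_antisymm (h.massSeries_le hA hp ht zero_le_one le_rfl i) ?_
  have hlim : Filter.Tendsto (fun k => ∑ j, (N ^ k) j i * d j) Filter.atTop (nhds 0) := by
    have := tendsto_finsetSum Finset.univ fun j _ =>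
      (tendsto_pow_of_specRadius_lt_one N hsub j i).mul_const (d j)
    simpa using this
  have := ge_of_tendsto' hlim fun k => hdk k i
  exact sub_nonpos.1 this

/-- If $g(1)=p$, the deficit $d(s)$ tends to 0 as $s\uparrow1$ yet is not identically zero for
$s<1$. Testing the nearly linear equation against a subinvariant vector $u$ of $AP$ then contradicts
supercriticality. -/
theorem IsTreeDistribution.exists_massSeries_one_lt [NeZero m] (h : IsTreeDistribution A p t w)
    (hsymm : A.IsSymm) (hA : ∀ i j, 0 ≤ A i j) (hp : ∀ i, 0 ≤ p i) (ht : 0 ≤ t)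
    (hsup : 1 < t * specRadius (A * Matrix.diagonal p)) : ∃ i, massSeries w 1 i < p i := by
  by_contra! hcon
  set ρ := specRadius (A * Matrix.diagonal p) with hρ
  have hM : ∀ i j, 0 ≤ (A * Matrix.diagonal p) i j := fun i j => by
    rw [Matrix.mul_diagonal]
    exact mul_nonneg (hA i j) (hp j)
  have hρ0 : 0 < ρ := pos_of_mul_pos_right (one_pos.trans hsup) ht
  obtain ⟨u, hu0, hune, hu⟩ := exists_subinvariant _ hM
  rw [← hρ] at hu
  have hMu : ∀ i, (A * Matrix.diagonal p).mulVec u i = ∑ j, A i j * (p j * u j) := fun i => by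
    simp only [Matrix.mulVec, dotProduct, Matrix.mul_diagonal, mul_assoc]
  -- Since `u` may have zeros, an index charged by both `p` and `u` is needed. If there were none,
  -- then $APu=0$, and $\rho u\le APu$ would give $u=0$.
  obtain ⟨k, hk⟩ : ∃ k, 0 < p k * u k := by
    by_contra! hall
    refine hune (funext fun i => le_antisymm ?_ (hu0 i))
    have hz : ∀ j, p j * u j = 0 := fun j => le_antisymm (hall j) (mul_nonneg (hp j) (hu0 j))
    have := hu i
    rw [hMu] at this
    simp only [hz, mul_zero, Finset.sum_const_zero] at this
    exact nonpos_of_mul_nonpos_right this hρ0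
  set d : ℝ → Fin m → ℝ := fun s i => p i - massSeries w s i with hd
  set y : ℝ → Fin m → ℝ := fun s i => t * A.mulVec (d s) i with hy
  obtain ⟨ε, hε0, hε⟩ : ∃ ε : ℝ, 0 < ε ∧ 1 + ε < t * ρ :=
    ⟨(t * ρ - 1) / 2, by linarith, by linarith⟩
  have hcont : ∀ i, ContinuousOn (fun s => y s i) (Set.Icc 0 1) := fun i =>
    continuousOn_const.mul (show ContinuousOn (fun s => ∑ j, A i j * d s j) (Set.Icc 0 1) from
      continuousOn_finsetSum _ fun j _ => continuousOn_const.mul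
        (continuousOn_const.sub (h.continuousOn_massSeries hA hp ht j)))
  have hd1 : d 1 = 0 := funext fun i => le_antisymm (sub_nonpos.2 (hcon i))
    (sub_nonneg.2 (h.massSeries_le hA hp ht zero_le_one le_rfl i))
  have hlim : ∀ i, ∀ᶠ s in nhdsWithin (1 : ℝ) (Set.Ioo 0 1), y s i < ε := by
    intro i
    have hy1 : y 1 i = 0 := by simp [hy, hd1]
    have := ((hcont i 1 (Set.right_mem_Icc.2 zero_le_one)).mono Set.Ioo_subset_Icc_self).tendsto
    rw [hy1] at this
    exact this.eventually_lt_const hε0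
  have hbot : (nhdsWithin (1 : ℝ) (Set.Ioo 0 1)).NeBot :=
    mem_closure_iff_nhdsWithin_neBot.1 (by rw [closure_Ioo zero_ne_one]; simp)
  obtain ⟨s, hs, hs01⟩ := ((Filter.eventually_all.2 hlim).and self_mem_nhdsWithin).exists
  have hd0 : ∀ i, 0 ≤ d s i := fun i =>
    sub_nonneg.2 (h.massSeries_le hA hp ht hs01.1.le hs01.2.le i)
  have hy0 : ∀ i, 0 ≤ y s i := fun i =>
    mul_nonneg ht (show 0 ≤ ∑ j, A i j * d s j from
      Finset.sum_nonneg fun j _ => mul_nonneg (hA i j) (hd0 j))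
  have hdeq : ∀ i, d s i = p i - s * (p i * Real.exp (-y s i)) := fun i =>
    congrArg (p i - ·) (h.massSeries_eq hA hp ht hs01.1.le hs01.2.le i)
  -- For $0\le y\le\varepsilon$ one has $y\le(1+y)(1-e^{-y})\le(1+\varepsilon)(1-e^{-y})$, and
  -- $p_i(1-e^{-y_i})\le d_i$ because $s<1$.
  have hlow : ∀ i, p i * y s i ≤ (1 + ε) * d s i := by
    intro i
    have e1 : Real.exp (-y s i) * (1 + y s i) ≤ 1 := by
      have h1 := Real.add_one_le_exp (y s i)
      have h2 := mul_le_mul_of_nonneg_left h1 (Real.exp_pos (-y s i)).le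
      rw [← Real.exp_add, neg_add_cancel, Real.exp_zero] at h2
      linarith
    have e0 := Real.exp_pos (-y s i)
    have e2 : Real.exp (-y s i) ≤ 1 := Real.exp_le_one_iff.2 (neg_nonpos.2 (hy0 i))
    have e3 : y s i ≤ (1 + ε) * (1 - Real.exp (-y s i)) := by
      have := mul_nonneg (sub_nonneg.2 (hs i).le) (sub_nonneg.2 e2)
      linarith
    have e4 : p i * (1 - Real.exp (-y s i)) ≤ d s i := by
      rw [hdeq]
      have := mul_nonneg (sub_nonneg.2 hs01.2.le) (mul_nonneg (hp i) e0.le)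
      linarith
    calc p i * y s i ≤ p i * ((1 + ε) * (1 - Real.exp (-y s i))) :=
          mul_le_mul_of_nonneg_left e3 (hp i)
      _ = (1 + ε) * (p i * (1 - Real.exp (-y s i))) := by ring
      _ ≤ (1 + ε) * d s i := mul_le_mul_of_nonneg_left e4 (by linarith)
  -- Here $s<1$ is essential: $d_k(s)\ge p_k(1-s)>0$.
  have hpos : 0 < ∑ i, u i * d s i := by
    refine Finset.sum_pos' (fun i _ => mul_nonneg (hu0 i) (hd0 i)) ⟨k, Finset.mem_univ k, ?_⟩
    have hpk : 0 < p k := pos_of_mul_pos_left hk (hu0 k)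
    refine mul_pos (pos_of_mul_pos_right hk (hp k)) ?_
    rw [hdeq]
    have e2 : Real.exp (-y s k) ≤ 1 := Real.exp_le_one_iff.2 (neg_nonpos.2 (hy0 k))
    have e3 : p k * Real.exp (-y s k) ≤ p k := mul_le_of_le_one_right hpk.le e2
    have e4 := mul_le_mul_of_nonneg_left e3 hs01.1.le
    have e5 := mul_lt_mul_of_pos_right hs01.2 hpk
    linarith
  have hchain : t * ρ * ∑ i, u i * d s i ≤ (1 + ε) * ∑ i, u i * d s i := by
    calc t * ρ * ∑ i, u i * d s i = ∑ i, t * d s i * (ρ * u i) := by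
          rw [Finset.mul_sum]
          exact Finset.sum_congr rfl fun i _ => by ring
      _ ≤ ∑ i, t * d s i * ∑ j, A i j * (p j * u j) := by
          refine Finset.sum_le_sum fun i _ => mul_le_mul_of_nonneg_left ?_ (mul_nonneg ht (hd0 i))
          rw [← hMu]
          exact hu i
      _ = ∑ j, u j * (p j * y s j) := by
          simp only [hy, Matrix.mulVec, dotProduct, Finset.mul_sum]
          rw [Finset.sum_comm]
          refine Finset.sum_congr rfl fun j _ => Finset.sum_congr rfl fun i _ => ?_
          rw [hsymm.apply j i]
          ring
      _ ≤ ∑ j, u j * ((1 + ε) * d s j) :=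
          Finset.sum_le_sum fun j _ => mul_le_mul_of_nonneg_left (hlow j) (hu0 j)
      _ = (1 + ε) * ∑ i, u i * d s i := by
          rw [Finset.mul_sum]
          exact Finset.sum_congr rfl fun i _ => by ring
  exact absurd (le_of_mul_le_mul_right hchain hpos) (not_le.2 hε)

end Phase

/-! ### Explicit solution of the reduced equation and its uniqueness -/

section Existence

theorem kernel_eq_sum (A : Matrix (Fin m) (Fin m) ℝ) (k l : Fin m → ℕ) :
    kernel A k l = ∑ i, ∑ j, A i j * (k i * l j) := by
  simp only [kernel, Matrix.mulVec, dotProduct, Finset.mul_sum]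
  refine Finset.sum_congr rfl fun i _ => Finset.sum_congr rfl fun j _ => ?_
  ring

theorem kernel_zero_left (A : Matrix (Fin m) (Fin m) ℝ) (l : Fin m → ℕ) : kernel A 0 l = 0 := by
  simp [kernel_eq_sum]

theorem kernel_zero_right (A : Matrix (Fin m) (Fin m) ℝ) (k : Fin m → ℕ) : kernel A k 0 = 0 := by
  simp [kernel_eq_sum]

theorem kernel_nonneg (hA : ∀ i j, 0 ≤ A i j) (k l : Fin m → ℕ) : 0 ≤ kernel A k l := by
  rw [kernel_eq_sum]
  exact Finset.sum_nonneg fun i _ => Finset.sum_nonneg fun j _ => mul_nonneg (hA i j) (by positivity)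

/-- The time-independent weights `c_n` in `w_n(t) = c_n t^{|n| - 1} exp (-t nᵀ A p)`. -/
noncomputable def treeWeight (A : Matrix (Fin m) (Fin m) ℝ) (p : Fin m → ℝ)
    (n : Fin m →₀ ℕ) : ℝ :=
  if n.degree ≤ 1 then ∑ i, n i * p i
  else (∑ kl ∈ antidiagonal n,
    if _h : kl.1.degree < n.degree ∧ kl.2.degree < n.degree then
      kernel A kl.1 kl.2 * (treeWeight A p kl.1 * treeWeight A p kl.2) else 0) /
        (2 * ((n.degree : ℝ) - 1))
termination_by n.degree
decreasing_by
  · exact _h.1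
  · exact _h.2

theorem treeWeight_of_degree_le_one {n : Fin m →₀ ℕ} (h : n.degree ≤ 1) :
    treeWeight A p n = ∑ i, n i * p i := by
  rw [treeWeight, if_pos h]

theorem treeWeight_nonneg (hA : ∀ i j, 0 ≤ A i j) (hp : ∀ i, 0 ≤ p i) (n : Fin m →₀ ℕ) :
    0 ≤ treeWeight A p n := by
  have key : ∀ N : ℕ, ∀ n : Fin m →₀ ℕ, n.degree = N → 0 ≤ treeWeight A p n := by
    intro N
    induction N using Nat.strong_induction_on with
    | _ N ih =>
      intro n hn
      rw [treeWeight]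
      split_ifs with h1
      · exact Finset.sum_nonneg fun i _ => mul_nonneg (Nat.cast_nonneg _) (hp i)
      · refine div_nonneg (Finset.sum_nonneg fun kl _ => ?_) ?_
        · split_ifs with h
          · rw [hn] at h
            exact mul_nonneg (kernel_nonneg hA _ _)
              (mul_nonneg (ih _ h.1 _ rfl) (ih _ h.2 _ rfl))
          · exact le_rfl
        · have : (1 : ℝ) ≤ n.degree := by exact_mod_cast (not_le.1 h1).le
          linarith
  exact key _ n rfl

/-- The pairs dropped by the guard in `treeWeight` have a zero component, so the full recursion
holds without the guard. -/
theorem kernel_eq_zero_of_degree {n : Fin m →₀ ℕ} {kl : (Fin m →₀ ℕ) × (Fin m →₀ ℕ)}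
    (hkl : kl ∈ antidiagonal n) (h : ¬(kl.1.degree < n.degree ∧ kl.2.degree < n.degree)) :
    kernel A kl.1 kl.2 = 0 := by
  rw [mem_antidiagonal] at hkl
  have hd : kl.1.degree + kl.2.degree = n.degree := by rw [← map_add, hkl]
  rcases Nat.eq_zero_or_pos kl.1.degree with h1 | h1
  · rw [(Finsupp.degree_eq_zero_iff _).1 h1, Finsupp.coe_zero, kernel_zero_left]
  · rw [(Finsupp.degree_eq_zero_iff kl.2).1 (by omega), Finsupp.coe_zero, kernel_zero_right]

theorem treeWeight_recursion (A : Matrix (Fin m) (Fin m) ℝ) (p : Fin m → ℝ) (n : Fin m →₀ ℕ) :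
    2 * (((n.degree : ℝ) - 1) * treeWeight A p n) = ∑ kl ∈ antidiagonal n,
      kernel A kl.1 kl.2 * (treeWeight A p kl.1 * treeWeight A p kl.2) := by
  by_cases h1 : n.degree ≤ 1
  · have hz : ∑ kl ∈ antidiagonal n,
        kernel A kl.1 kl.2 * (treeWeight A p kl.1 * treeWeight A p kl.2) = 0 := by
      refine Finset.sum_eq_zero fun kl hkl => ?_
      by_cases h : kl.1.degree < n.degree ∧ kl.2.degree < n.degree
      · rw [(Finsupp.degree_eq_zero_iff kl.1).1 (by omega), Finsupp.coe_zero, kernel_zero_left,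
          zero_mul]
      · rw [kernel_eq_zero_of_degree hkl h, zero_mul]
    rw [hz, treeWeight_of_degree_le_one h1]
    rcases Nat.eq_zero_or_pos n.degree with h0 | h0
    · rw [Finsupp.degree_eq_zero_iff] at h0
      simp [h0]
    · rw [show n.degree = 1 by omega]
      simp
  · rw [treeWeight, if_neg h1, ← mul_assoc, mul_div_cancel₀]
    · refine Finset.sum_congr rfl fun kl hkl => ?_
      split_ifs with h
      · rfl
      · rw [kernel_eq_zero_of_degree hkl h, zero_mul]
    · have : (1 : ℝ) < n.degree := by exact_mod_cast not_le.1 h1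
      have : (n.degree : ℝ) - 1 ≠ 0 := by linarith
      simpa using this

/-- The explicit solution `w_n(t) = c_n t^{|n| - 1} exp (-t nᵀ A p)` of the reduced equation. -/
noncomputable def treeSolution (A : Matrix (Fin m) (Fin m) ℝ) (p : Fin m → ℝ) (t : ℝ)
    (n : Fin m →₀ ℕ) : ℝ :=
  treeWeight A p n * t ^ (n.degree - 1) * Real.exp (-(t * ((fun i => (n i : ℝ)) ⬝ᵥ A.mulVec p)))

theorem exp_dotProduct_add (t : ℝ) (q : Fin m → ℝ) (k l : Fin m →₀ ℕ) :
    Real.exp (-(t * ((fun i => ((k + l) i : ℝ)) ⬝ᵥ q))) =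
      Real.exp (-(t * ((fun i => (k i : ℝ)) ⬝ᵥ q))) *
        Real.exp (-(t * ((fun i => (l i : ℝ)) ⬝ᵥ q))) := by
  rw [← Real.exp_add]
  congr 1
  simp only [dotProduct, Finsupp.add_apply, Nat.cast_add, add_mul, Finset.sum_add_distrib]
  ring

theorem isTreeDistribution_treeSolution (hsymm : A.IsSymm) (hA : ∀ i j, 0 ≤ A i j)
    (hp : ∀ i, 0 ≤ p i) {t : ℝ} (ht : 0 ≤ t) : IsTreeDistribution A p t (treeSolution A p t) where
  nonneg n := mul_nonneg (mul_nonneg (treeWeight_nonneg hA hp n) (pow_nonneg ht _))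
    (Real.exp_pos _).le
  recursion n i := by
    have h := tree_recursion A hsymm (treeWeight A p) (fun n => by
      simpa only [kernel_eq_sum] using treeWeight_recursion A p n) n i
    calc ((n.degree : ℝ) - 1) * (n i * treeSolution A p t n)
        = (((n.degree : ℝ) - 1) * (n i * treeWeight A p n)) * (t ^ (n.degree - 1) *
            Real.exp (-(t * ((fun i => (n i : ℝ)) ⬝ᵥ A.mulVec p)))) := by
          rw [treeSolution]
          ring
      _ = _ := by
          rw [h, Finset.sum_mul, Finset.mul_sum]
          refine Finset.sum_congr rfl fun kl hkl => ?_
          rw [mem_antidiagonal] at hkl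
          rcases Nat.eq_zero_or_pos kl.1.degree with h1 | h1
          · rw [Finsupp.degree_eq_zero_iff] at h1
            simp [h1]
          rcases Nat.eq_zero_or_pos kl.2.degree with h2 | h2
          · rw [Finsupp.degree_eq_zero_iff] at h2
            simp [h2]
          have hd : n.degree - 1 = 1 + (kl.1.degree - 1) + (kl.2.degree - 1) := by
            rw [← hkl, map_add]
            omega
          rw [hd, ← hkl, exp_dotProduct_add, pow_add, pow_add, pow_one]
          simp only [treeSolution, Finset.mul_sum, Finset.sum_mul]
          refine Finset.sum_congr rfl fun j _ => ?_
          ring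
  single i := by
    have h1 : (Finsupp.single i 1).degree = 1 := Finsupp.degree_single i 1
    have e1 : ∀ q : Fin m → ℝ, ∑ j, ((Finsupp.single i 1 j : ℕ) : ℝ) * q j = q i := fun q => by
      simp [Finsupp.single_apply]
    rw [treeSolution, treeWeight_of_degree_le_one h1.le, h1, e1, dotProduct, e1]
    simp

/-- Translates between the function-indexed convolution of `reducedRhs` and the `Finsupp`
antidiagonal used for power series. -/
theorem sum_filter_add_eq (n : Fin m → ℕ) (f : (Fin m → ℕ) → (Fin m → ℕ) → ℝ) :
    ∑ kl ∈ Finset.Iic n ×ˢ Finset.Iic n with kl.1 + kl.2 = n, f kl.1 kl.2 =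
      ∑ kl ∈ antidiagonal (Finsupp.equivFunOnFinite.symm n), f kl.1 kl.2 := by
  refine Finset.sum_nbij'
    (fun kl => (Finsupp.equivFunOnFinite.symm kl.1, Finsupp.equivFunOnFinite.symm kl.2))
    (fun kl => (⇑kl.1, ⇑kl.2)) ?_ ?_ ?_ ?_ ?_
  · intro kl hkl
    rw [Finset.mem_filter] at hkl
    rw [mem_antidiagonal]
    ext i
    exact congrFun hkl.2 i
  · intro kl hkl
    rw [mem_antidiagonal] at hkl
    have h : (⇑kl.1 : Fin m → ℕ) + ⇑kl.2 = n := by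
      rw [← Finsupp.coe_add, hkl]
      rfl
    rw [Finset.mem_filter, Finset.mem_product, Finset.mem_Iic, Finset.mem_Iic]
    refine ⟨⟨?_, ?_⟩, h⟩
    · exact h ▸ le_self_add
    · exact h ▸ le_add_self
  · intro kl _
    rfl
  · intro kl _
    ext <;> rfl
  · intro kl _
    rfl

theorem treeSolution_zero (n : Fin m → ℕ) :
    treeSolution A p 0 (Finsupp.equivFunOnFinite.symm n) = monodisperse p n := by
  set n' := Finsupp.equivFunOnFinite.symm n with hn'
  have h : treeWeight A p n' * 0 ^ (n'.degree - 1) =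
      ∑ i, (n' i * 0 ^ (n'.degree - 1)) * p i := by
    rcases Nat.lt_or_ge 1 n'.degree with h1 | h1
    · simp [zero_pow (show n'.degree - 1 ≠ 0 by omega)]
    · rw [treeWeight_of_degree_le_one h1, Finset.sum_mul]
      exact Finset.sum_congr rfl fun i _ => by ring
  have hiff : ∀ i, n' = Finsupp.single i 1 ↔ n = Pi.single i 1 := by
    intro i
    rw [hn', Equiv.symm_apply_eq, Finsupp.equivFunOnFinite_single]
  rw [treeSolution, h, monodisperse, zero_mul, neg_zero, Real.exp_zero, mul_one]
  refine Finset.sum_congr rfl fun i _ => ?_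
  rw [apply_mul_zero_pow_degree, ite_mul, one_mul, zero_mul]
  simp only [hiff]

theorem totalMass_treeSolution (t : ℝ) :
    totalMass (fun n => treeSolution A p t (Finsupp.equivFunOnFinite.symm n)) =
      massSeries (treeSolution A p t) 1 := by
  ext i
  rw [totalMass, massSeries, ← Finsupp.equivFunOnFinite.tsum_eq]
  refine tsum_congr fun n => ?_
  rw [one_pow, mul_one, Equiv.symm_apply_apply]
  rfl

/-- At $t=0$ the exponential in the functional equation is 1, so $g(1)=p$. -/
theorem totalMass_monodisperse (hsymm : A.IsSymm) (hA : ∀ i j, 0 ≤ A i j) (hp : ∀ i, 0 ≤ p i) :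
    totalMass (monodisperse p) = p := by
  have h : monodisperse p =
      fun n => treeSolution A p 0 (Finsupp.equivFunOnFinite.symm n) :=
    funext fun n => (treeSolution_zero n).symm
  rw [h, totalMass_treeSolution]
  ext i
  rw [(isTreeDistribution_treeSolution hsymm hA hp le_rfl).massSeries_eq hA hp le_rfl zero_le_one
    le_rfl]
  simp

theorem isReducedSolution_treeSolution (hsymm : A.IsSymm) (hA : ∀ i j, 0 ≤ A i j)
    (hp : ∀ i, 0 ≤ p i) : IsReducedSolution A p
      fun t n => treeSolution A p t (Finsupp.equivFunOnFinite.symm n) := by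
  have hinit : (fun n => treeSolution A p 0 (Finsupp.equivFunOnFinite.symm n)) = monodisperse p :=
    funext treeSolution_zero
  refine ⟨hinit, fun t _ n => ?_⟩
  rw [hinit, totalMass_monodisperse hsymm hA hp, reducedRhs]
  set n' := Finsupp.equivFunOnFinite.symm n with hn'
  set a := (fun i => (n i : ℝ)) ⬝ᵥ A.mulVec p with ha
  have hd : HasDerivAt (fun s => treeSolution A p s n')
      (treeWeight A p n' * (((n'.degree - 1 : ℕ) : ℝ) * t ^ (n'.degree - 1 - 1)) *
        Real.exp (-(t * a)) + treeWeight A p n' * t ^ (n'.degree - 1) *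
        (Real.exp (-(t * a)) * -(1 * a))) t :=
    ((hasDerivAt_pow (n'.degree - 1) t).const_mul _).mul
      (((hasDerivAt_id t).mul_const a).neg.exp)
  refine (hd.congr_deriv ?_).hasDerivWithinAt
  rw [sum_filter_add_eq n fun k l => kernel A k l *
    treeSolution A p t (Finsupp.equivFunOnFinite.symm k) *
    treeSolution A p t (Finsupp.equivFunOnFinite.symm l), ← hn']
  have hsum : ∑ kl ∈ antidiagonal n', kernel A kl.1 kl.2 *
      treeSolution A p t (Finsupp.equivFunOnFinite.symm kl.1) *
      treeSolution A p t (Finsupp.equivFunOnFinite.symm kl.2) =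
      (2 * (((n'.degree : ℝ) - 1) * treeWeight A p n')) *
        (t ^ (n'.degree - 1 - 1) * Real.exp (-(t * a))) := by
    rw [treeWeight_recursion, Finset.sum_mul]
    refine Finset.sum_congr rfl fun kl hkl => ?_
    by_cases hlt : kl.1.degree < n'.degree ∧ kl.2.degree < n'.degree
    · rw [mem_antidiagonal] at hkl
      have hdeg : kl.1.degree + kl.2.degree = n'.degree := by rw [← map_add, hkl]
      have he := exp_dotProduct_add t (A.mulVec p) kl.1 kl.2
      rw [hkl] at he
      change Real.exp (-(t * a)) = _ at he
      rw [he, show n'.degree - 1 - 1 = (kl.1.degree - 1) + (kl.2.degree - 1) by omega, pow_add,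
        Finsupp.equivFunOnFinite_symm_coe, Finsupp.equivFunOnFinite_symm_coe, treeSolution,
        treeSolution]
      ring
    · rw [kernel_eq_zero_of_degree hkl hlt]
      ring
  have hw : treeSolution A p t n' = treeWeight A p n' * t ^ (n'.degree - 1) *
    Real.exp (-(t * a)) := rfl
  -- Truncated subtraction is wrong only at $n=0$, where the weight is zero.
  have hcast : treeWeight A p n' * ((n'.degree - 1 : ℕ) : ℝ) =
      ((n'.degree : ℝ) - 1) * treeWeight A p n' := by
    rcases Nat.eq_zero_or_pos n'.degree with h0 | h0
    · have hz : treeWeight A p n' = 0 := by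
        rw [treeWeight_of_degree_le_one (by omega), (Finsupp.degree_eq_zero_iff _).1 h0]
        simp
      rw [hz, zero_mul, mul_zero]
    · rw [Nat.cast_sub h0, Nat.cast_one, mul_comm]
  rw [hsum, hw]
  linear_combination (t ^ (n'.degree - 1 - 1) * Real.exp (-(t * a))) * hcast

/-- Solutions of the reduced equation agree for nonnegative times. -/
theorem IsReducedSolution.eq_of_nonneg {w w' : ℝ → (Fin m → ℕ) → ℝ}
    (h : IsReducedSolution A p w) (h' : IsReducedSolution A p w') {t : ℝ} (ht : 0 ≤ t) :
    w t = w' t := by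
  have key : ∀ N : ℕ, ∀ n : Fin m → ℕ, ∑ i, n i = N → ∀ t, 0 ≤ t → w t n = w' t n := by
    intro N
    induction N using Nat.strong_induction_on with
    | _ N ih =>
      intro n hn t ht
      set a := (fun i => (n i : ℝ)) ⬝ᵥ A.mulVec (totalMass (monodisperse p)) with ha
      have hpos : ∀ k : Fin m → ℕ, k ≠ 0 → 0 < ∑ i, k i := by
        intro k hk
        obtain ⟨i, hi⟩ := Function.ne_iff.1 hk
        exact Finset.sum_pos' (fun _ _ => Nat.zero_le _)
          ⟨i, Finset.mem_univ i, Nat.pos_of_ne_zero hi⟩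
      -- The kernel vanishes when a component is zero, so the gain terms involve only smaller sizes
      -- and agree by induction. The difference thus solves $x'=-ax$, with integrating factor
      -- $e^{sa}$.
      have hrhs : ∀ s, 0 ≤ s →
          reducedRhs A (totalMass (w 0)) (w s) n - reducedRhs A (totalMass (w' 0)) (w' s) n =
            -a * (w s n - w' s n) := by
        intro s hs
        rw [h.initial, h'.initial, reducedRhs, reducedRhs, ← ha]
        have hsum : ∑ kl ∈ Finset.Iic n ×ˢ Finset.Iic n with kl.1 + kl.2 = n,
            kernel A kl.1 kl.2 * w s kl.1 * w s kl.2 =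
            ∑ kl ∈ Finset.Iic n ×ˢ Finset.Iic n with kl.1 + kl.2 = n,
            kernel A kl.1 kl.2 * w' s kl.1 * w' s kl.2 := by
          refine Finset.sum_congr rfl fun kl hkl => ?_
          have hadd := (Finset.mem_filter.1 hkl).2
          have hN : ∑ i, kl.1 i + ∑ i, kl.2 i = N := by
            rw [← Finset.sum_add_distrib, ← hn, ← hadd]
            rfl
          by_cases h1 : kl.1 = 0
          · rw [h1, kernel_zero_left]
            ring
          by_cases h2 : kl.2 = 0
          · rw [h2, kernel_zero_right]
            ring
          have p1 := hpos _ h1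
          have p2 := hpos _ h2
          rw [ih _ (by omega) kl.1 rfl s hs, ih _ (by omega) kl.2 rfl s hs]
        rw [hsum]
        ring
      have hder : ∀ s, 0 ≤ s → HasDerivWithinAt
          (fun s => (w s n - w' s n) * Real.exp (s * a)) 0 (Set.Ici 0) s := by
        intro s hs
        have h1 := ((h.ode s hs n).sub (h'.ode s hs n)).mul
          (((hasDerivAt_id s).mul_const a).exp.hasDerivWithinAt (s := Set.Ici 0))
        refine h1.congr_deriv ?_
        rw [hrhs s hs]
        simp only [Pi.sub_apply, id]
        ring
      have hconst := constant_of_has_deriv_right_zero (a := 0) (b := t)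
        (fun s hs => ((hder s hs.1).continuousWithinAt).mono Set.Icc_subset_Ici_self)
        (fun s hs => (hder s hs.1).mono (Set.Ici_subset_Ici.2 hs.1)) t ⟨ht, le_rfl⟩
      rw [h.initial, h'.initial, sub_self, zero_mul] at hconst
      exact sub_eq_zero.1 ((mul_eq_zero.1 hconst).resolve_right (Real.exp_pos _).ne')
  exact funext fun n => key _ n rfl t ht

end Existence

/-! ### The gelation time -/

section Gelation

theorem IsGelationTime.unique {w : ℝ → (Fin m → ℕ) → ℝ} {T T' : ℝ} (h : IsGelationTime w T)
    (h' : IsGelationTime w T') : T = T' := by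
  have key : ∀ {T T' : ℝ}, IsGelationTime w T → IsGelationTime w T' → ¬T < T' := by
    intro T T' h h' hlt
    obtain ⟨t, h1, h2⟩ := exists_between hlt
    obtain ⟨i, hi⟩ := h.loss t h1
    exact hi.ne (congrFun (h'.conserved t (h.pos.trans h1).le h2) i)
  exact le_antisymm (not_lt.1 (key h' h)) (not_lt.1 (key h h'))

theorem IsReducedSolution.isGelationTime [NeZero m] {w : ℝ → (Fin m → ℕ) → ℝ}
    (h : IsReducedSolution A p w) (hsymm : A.IsSymm) (hA : ∀ i j, 0 ≤ A i j) (hp : ∀ i, 0 ≤ p i)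
    (hρ : 0 < specRadius (A * Matrix.diagonal p)) :
    IsGelationTime w (1 / specRadius (A * Matrix.diagonal p)) := by
  have hw : ∀ t, 0 ≤ t → w t = fun n => treeSolution A p t (Finsupp.equivFunOnFinite.symm n) :=
    fun t ht => h.eq_of_nonneg (isReducedSolution_treeSolution hsymm hA hp) ht
  have htree := fun {t : ℝ} (ht : 0 ≤ t) => isTreeDistribution_treeSolution hsymm hA hp ht
  have hmass : ∀ t, 0 ≤ t → totalMass (w t) = massSeries (treeSolution A p t) 1 := fun t ht => by
    rw [hw t ht, totalMass_treeSolution]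
  have hmass0 : totalMass (w 0) = p := by rw [h.initial, totalMass_monodisperse hsymm hA hp]
  refine ⟨one_div_pos.2 hρ, fun t ht i => ?_, fun t ht hlt => ?_, fun t hlt => ?_⟩
  · rw [hw t ht, ← Finsupp.equivFunOnFinite.summable_iff]
    convert! (htree ht).summable hA hp ht i using 2 with n
    simp
  · rw [hmass t ht, hmass0]
    refine (htree ht).massSeries_one_eq hsymm hA hp ht ?_
    rwa [specRadius_smul _ ht, ← lt_div_iff₀ hρ]
  · have ht := (one_div_pos.2 hρ).trans hlt
    rw [hmass t ht.le, hmass0]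
    exact (htree ht.le).exists_massSeries_one_lt hsymm hA hp ht.le ((div_lt_iff₀ hρ).1 hlt)

end Gelation

end MultiCoag

theorem corollary1 (m : ℕ) (A : Matrix (Fin m) (Fin m) ℝ) (hsymm : A.IsSymm)
    (hirr : A.IsIrreducible) (p : Fin m → ℝ) (hp : ∀ i, 0 ≤ p i) (hp1 : ∑ i, p i = 1)
    (hne : ∃ i j, 0 < p i * A i j * p j) :
    ∃ Tc : ℝ, 0 < Tc ∧ Tc = 1 / MultiCoag.specRadius (A * Matrix.diagonal p) ∧
      (∀ t : ℝ, 0 ≤ t → ((MultiCoag.assocProcess A p hp hp1 t).IsCritical ↔ t = Tc)) ∧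
      (∃ w : ℝ → (Fin m → ℕ) → ℝ, MultiCoag.IsReducedSolution A p w) ∧
      ∀ w : ℝ → (Fin m → ℕ) → ℝ, MultiCoag.IsReducedSolution A p w →
        ∀ T : ℝ, MultiCoag.IsGelationTime w T ↔ T = Tc := by
  have hA := hirr.nonneg
  obtain ⟨i, j, hij⟩ := hne
  have : NeZero m := ⟨fun h => (h ▸ i).elim0⟩
  have hpij : 0 < p i * A i j := pos_of_mul_pos_left hij (hp j)
  have hpj : 0 < p j := pos_of_mul_pos_right hij hpij.le
  have hpi : 0 < p i := pos_of_mul_pos_left hpij (hA i j)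
  have hAij : 0 < A i j := pos_of_mul_pos_right hpij hpi.le
  -- By symmetry $p_iA_{ij}p_j>0$ makes both the $(i,j)$ and the $(j,i)$ entries of $AP$ positive.
  have hρ : 0 < MultiCoag.specRadius (A * Matrix.diagonal p) := by
    refine MultiCoag.specRadius_pos _ (fun k l => ?_) (i := i) (j := j) ?_ ?_
    · rw [Matrix.mul_diagonal]
      exact mul_nonneg (hA k l) (hp l)
    · rw [Matrix.mul_diagonal]
      exact mul_pos hAij hpj
    · rw [Matrix.mul_diagonal, hsymm.apply]
      exact mul_pos hAij hpi
  refine ⟨_, one_div_pos.2 hρ, rfl, fun t ht => ?_,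
    ⟨_, MultiCoag.isReducedSolution_treeSolution hsymm hA hp⟩, fun w hw T => ?_⟩
  · rw [MultiCoag.BranchingProcess.IsCritical, MultiCoag.meanMatrix_assocProcess A hA p hp hp1 ht,
      MultiCoag.specRadius_smul _ ht, eq_div_iff hρ.ne']
  · have h := hw.isGelationTime hsymm hA hp hρ
    exact ⟨fun hT => hT.unique h, fun hT => hT ▸ h⟩
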